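/- Let $k \ge 0$ be an integer. Let $D_k$ be the graph obtained from the cycle $C_4 = (v_1, v_2, v_3, v_4)$ by adding one pendant edge at $v_1$, one pendant edge at $v_2$ and $k$ pendant edges at $v_4$. A bipartite graph is chordal bipartite if it has no induced cycle of length at least $6$, and a graph is $D_k$-free if it has no induced subgraph isomorphic to $D_k$. A class $\mathcal X$ of finite simple graphs admits an implicit representation if there are a constant $c$ and a function $D : \{0,1\}^* \times \{0,1\}^* \to \{0,1\}$, depending only on $\mathcal X$, such that the vertices of every $n$-vertex graph $G \in \mathcal X$ can be assigned binary codes of length at most $c\lfloor\log_2 n\rfloor$ in such a way that, for any two vertices $x, y$ of $G$ with codes $\ell(x), \ell(y)$, $x$ and $y$ are adjacent if and only if $D(\ell(x), \ell(y)) = 1$. Theorem. For every $k$, the class of $D_k$-free chordal bipartite graphs admits an implicit representation. -/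

import Mathlib

universe u

/-- A property of graphs on vertex types in a fixed universe (a class of graphs). -/
abbrev GraphClass : Type (u + 1) := ∀ V : Type u, SimpleGraph V → Prop

/-- A class of graphs admits an implicit representation if there are a constant `c` and one
adjacency function `D` on pairs of binary words, both depending on the class only, such that the
vertices of every finite `n`-vertex graph of the class can be given binary codes of length at most
`c * ⌊log₂ n⌋` so that the adjacency of any two vertices is the value of `D` on their codes. -/
def AdmitsImplicitRepresentation (X : GraphClass.{u}) : Prop :=
  ∃ (c : ℕ) (D : List Bool → List Bool → Bool),
    ∀ (V : Type u) [Fintype V] (G : SimpleGraph V), X V G →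
      ∃ code : V → List Bool,
        (∀ v, (code v).length ≤ c * Nat.log 2 (Fintype.card V)) ∧
        ∀ v w, G.Adj v w ↔ D (code v) (code w) = true

/-- A chordal bipartite graph: a bipartite graph without induced cycles of length at least `6`. -/
def IsChordalBipartite {V : Type*} (G : SimpleGraph V) : Prop :=
  G.IsBipartite ∧ ∀ m : ℕ, 6 ≤ m → ¬ (SimpleGraph.cycleGraph m).IsIndContained G

/-- The graph obtained from `H` by adding, for every `p : P`, a new vertex `Sum.inr p` whose only
neighbour is the vertex `f p` of `H`. -/
def withPendants {V P : Type*} (H : SimpleGraph V) (f : P → V) : SimpleGraph (V ⊕ P) where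
  Adj
    | .inl a, .inl b => H.Adj a b
    | .inl a, .inr p => f p = a
    | .inr p, .inl a => f p = a
    | .inr _, .inr _ => False
  symm := ⟨by
    rintro (a | p) (b | q) h
    · exact H.adj_symm h
    · exact h
    · exact h
    · exact h⟩
  loopless := ⟨by
    rintro (a | p) h
    · exact H.loopless.irrefl a h
    · exact h⟩

/-- The graph `D_k`: the cycle `C₄` with consecutive vertices `v₁, v₂, v₃, v₄`, here `0, 1, 2, 3`,
with one pendant edge added at `v₁`, one at `v₂`, and `k` at `v₄`. -/
def graphD (k : ℕ) : SimpleGraph (Fin 4 ⊕ (Fin 2 ⊕ Fin k)) :=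
  withPendants (SimpleGraph.cycleGraph 4)
    (Sum.elim (fun i : Fin 2 => if i = 0 then 0 else 1) (fun _ => 3))

/-- The class of `D_k`-free chordal bipartite graphs. -/
def dFreeChordalBipartite (k : ℕ) : GraphClass.{u} :=
  fun _ G => IsChordalBipartite G ∧ ¬ (graphD k).IsIndContained G

/-! Take one colour class as rows and the other as columns. It suffices to enumerate the columns so
that the number of changes of adjacency along each row is bounded in terms of `k`. A row is then
labelled by its places of change and a column by its position, and adjacency is a parity.

A doubly lexical ordering of a chordal bipartite relation contains no Γ (`exists_doubly_lexical`,
`gamma_free_of_doubly_lexical`), so rows after `w` meet `w` in final segments of `w`. The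
enumeration comes from an elimination read backwards (`exists_isReduction`). Merging twin columns or
dropping a short first row costs the surviving rows nothing. If the first row `w` is long, its
elements are thinned out to at most `2k + 4`, and rows with at most `k + 3` elements outside `w` are
dropped. Deleted columns return next to kept elements of `w`, so a surviving row pays, at most 4,
only if its final segment starts in one of two gaps (`IsSplit`).

By `D_k`-freeness a row `u` pays at most six times (`card_split_le`). If it pays at `w₁` and later
at `w₂`, then `w₁` and `w₂` are disjoint, or the remaining part of `w₂` inside `u`, or that outside
`u`, lies in `w₁`. The second case occurs at most twice for each `w₁`, because too few elements of
`w₁` are left. Three pairwise disjoint first rows would give an induced six-cycle. A row has at most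
`6k + 18` changes when dropped, whence the bound `6k + 18 + 4 * 6 = 6k + 42`. -/

/-- The number of places where membership in `p` changes along the list. -/
noncomputable def variation {β : Type*} (p : β → Prop) : List β → ℕ
  | [] => 0
  | [_] => 0
  | a :: b :: l => (open Classical in if (p a ↔ p b) then 0 else 1) + variation p (b :: l)

/-! ### Changes of membership along a list -/

section Variation

variable {β : Type*} (p : β → Prop)

/-- An element that agrees with its predecessor adds no change; any other adds at most two, one on
each side. -/
theorem variation_insert_one (l₁ l₂ : List β) (c y : β) :
    variation p (l₁ ++ c :: y :: l₂) ≤ variation p (l₁ ++ c :: l₂) + 2 * variation p [c, y] := by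
  induction l₁ with
  | nil =>
    cases l₂ with
    | nil => simp [variation]; split_ifs <;> omega
    | cons d l =>
      simp only [List.nil_append, variation]
      by_cases h1 : p c <;> by_cases h2 : p y <;> by_cases h3 : p d <;> simp [h1, h2, h3] <;> omega
  | cons a l ih =>
    cases l with
    | nil => simp only [List.nil_append, List.cons_append, variation] at ih ⊢; omega
    | cons b l => simp only [List.cons_append, variation] at ih ⊢; omega

theorem variation_insert_list (l₁ l₂ : List β) (c : β) (ys : List β) :
    variation p (l₁ ++ c :: (ys ++ l₂)) ≤ variation p (l₁ ++ c :: l₂) + 2 * variation p (c :: ys) := by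
  induction ys generalizing l₁ c with
  | nil => simp [variation]
  | cons y ys ih =>
    have h1 := ih (l₁ ++ [c]) y
    have h2 := variation_insert_one p l₁ l₂ c y
    simp only [List.append_assoc, List.cons_append, List.nil_append, variation] at h1 h2 ⊢
    omega

/-- A list of new elements can be inserted right after `c`, at a cost that depends only on the
variation of the new elements. -/
theorem exists_insert_after (l : List β) (c : β) (hc : c ∈ l) (ys : List β) :
    ∃ l' : List β, l'.Perm (ys ++ l) ∧
      ∀ p : β → Prop, variation p l' ≤ variation p l + 2 * variation p (c :: ys) := by
  obtain ⟨l₁, l₂, rfl⟩ := List.append_of_mem hc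
  refine ⟨l₁ ++ c :: (ys ++ l₂), ?_, fun p => variation_insert_list p l₁ l₂ c ys⟩
  have h : (l₁ ++ c :: (ys ++ l₂)) = l₁ ++ [c] ++ ys ++ l₂ := by simp
  have h' : ys ++ (l₁ ++ c :: l₂) = ys ++ (l₁ ++ [c]) ++ l₂ := by simp
  rw [h, h']
  exact List.perm_append_comm.append_right l₂

theorem variation_eq_zero (l : List β) (h : ∀ x ∈ l, ∀ y ∈ l, (p x ↔ p y)) :
    variation p l = 0 := by
  induction l with
  | nil => rfl
  | cons a l ih =>
    cases l with
    | nil => rfl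
    | cons b l =>
      have h1 : p a ↔ p b := h a (by simp) b (by simp)
      have h2 := ih fun x hx y hy => h x (List.mem_cons_of_mem _ hx) y (List.mem_cons_of_mem _ hy)
      simp [variation, h1, h2]

theorem variation_le_one (l : List β) (h : l.Pairwise fun x y => p x → p y) :
    variation p l ≤ 1 := by
  induction l with
  | nil => simp [variation]
  | cons a l ih =>
    cases l with
    | nil => simp [variation]
    | cons b l =>
      rw [List.pairwise_cons] at h
      by_cases hb : p b
      · have : variation p (b :: l) = 0 := by
          apply variation_eq_zero
          have hall : ∀ x ∈ b :: l, p x := by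
            intro x hx
            rcases List.mem_cons.1 hx with rfl | hx
            · exact hb
            · exact (List.pairwise_cons.1 h.2).1 x hx hb
          intro x hx y hy
          simp [hall x hx, hall y hy]
        simp only [variation, this]; split_ifs <;> omega
      · have ha : ¬ p a := fun ha => hb (h.1 b (by simp) ha)
        simp only [variation, ha, hb]; simpa using ih h.2

open Classical in
theorem variation_le_countP (l : List β) : variation p l ≤ 2 * l.countP (fun x => p x) := by
  -- A run of members at the head is entered without a change; the extra summand records this saving
  -- for the induction.
  have key : ∀ (l : List β) (a : β), variation p (a :: l) + (if p a then 1 else 0) ≤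
      2 * (a :: l).countP (fun x => p x) := by
    intro l
    induction l with
    | nil => intro a; by_cases h : p a <;> simp [variation, h]
    | cons b l ih =>
      intro a
      have := ih b
      rw [List.countP_cons]
      simp only [variation]
      by_cases ha : p a <;> by_cases hb : p b <;> simp_all <;> omega
  cases l with
  | nil => simp [variation]
  | cons a l => have := key l a; omega

/-- The positions, counted from `i`, at which membership in `p` changes along the list, when the
state before the list is `s`. -/
noncomputable def switches : Prop → ℕ → List β → List ℕ
  | _, _, [] => []
  | s, i, a :: l => open Classical in
    if (p a ↔ s) then switches s (i + 1) l else i :: switches (p a) (i + 1) l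

theorem le_of_mem_switches (l : List β) (s : Prop) (i x : ℕ) (hx : x ∈ switches p s i l) :
    i ≤ x ∧ x < i + l.length := by
  induction l generalizing s i with
  | nil => simp [switches] at hx
  | cons a l ih =>
    rw [switches] at hx
    split_ifs at hx
    · have := ih _ _ hx; simp; omega
    · rcases List.mem_cons.1 hx with rfl | hx
      · simp
      · have := ih _ _ hx; simp; omega

theorem length_switches_cons (l : List β) (i : ℕ) (a : β) :
    (switches p (p a) i l).length = variation p (a :: l) := by
  induction l generalizing i a with
  | nil => simp [switches, variation]
  | cons b l ih =>
    rw [switches, variation]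
    by_cases h : p b ↔ p a
    · have h' : p b = p a := propext h
      simp only [h', ← ih (i + 1) b]; simp
    · have h' : ¬ (p a ↔ p b) := fun h' => h h'.symm
      simp only [h, h', if_false, List.length_cons, ih (i + 1) b]; omega

theorem length_switches_le (l : List β) (s : Prop) (i : ℕ) :
    (switches p s i l).length ≤ variation p l + 1 := by
  cases l with
  | nil => simp [switches]
  | cons a l =>
    rw [switches]
    split_ifs with h
    · have h' : s = p a := propext h.symm
      rw [h', length_switches_cons]; omega
    · simp [length_switches_cons]

/-- Each switch flips the state, so membership at a position depends only on the parity of the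
switches up to it. -/
theorem get_iff_switches (l : List β) (s : Prop) (i j : ℕ) (hj : j < l.length) :
    p l[j] ↔ (s ↔ Even ((switches p s i l).countP (fun x => x ≤ i + j))) := by
  induction l generalizing s i j with
  | nil => simp at hj
  | cons a l ih =>
    rw [switches]
    have hz : ∀ t : Prop, (switches p t (i + 1) l).countP (fun x => x ≤ i) = 0 := by
      intro t
      rw [List.countP_eq_zero]
      intro x hx
      have := le_of_mem_switches p l t (i + 1) x hx
      simp; omega
    cases j with
    | zero =>
      split_ifs with h
      · simp [hz, h]
      · simp [hz]; tauto
    | succ j =>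
      have hj' : j < l.length := by simpa using hj
      have e : ∀ x : ℕ, (x ≤ i + (j + 1)) = (x ≤ i + 1 + j) := fun x => by congr 1; omega
      split_ifs with h
      · simpa [e] using ih s (i + 1) j hj'
      · have := ih (p a) (i + 1) j hj'
        rw [List.countP_cons]
        simp only [e, List.getElem_cons_succ]
        rw [this]
        have : i ≤ i + 1 + j := by omega
        simp only [this, decide_true, if_true, Nat.even_add_one]
        tauto

end Variation

/-! ### Doubly lexical orderings -/

/-- Distinct rows, ordered by `ρ`, are in colexicographic order with respect to the order of the
columns by `κ`. -/
def RowsColex {α β : Type*} (R : α → β → Prop) (ρ : α → ℕ) (κ : β → ℕ) : Prop :=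
  ∀ a a' c, ρ a < ρ a' → R a c → ¬ R a' c →
    ∃ c', κ c < κ c' ∧ ¬ R a c' ∧ R a' c' ∧ ∀ d, κ c' < κ d → (R a d ↔ R a' d)

section DoublyLexical

-- Rearrangement: exchanging the two weights changes the sum by `(f a' - f a) * (V a - V a')`, which
-- would be positive if `V a' < V a`.
open Classical in
theorem sum_mul_le_of_swap_maximal {α : Type*} [Fintype α] (f V : α → ℕ)
    (a a' : α) (h : f a < f a')
    (hmax : ∑ x, f (Equiv.swap a a' x) * V x ≤ ∑ x, f x * V x) : V a ≤ V a' := by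
  have hne : a ≠ a' := fun e => by simp [e] at h
  have hs : ∀ g : α → ℕ, ∑ x, g x = g a + (g a' + ∑ x ∈ (Finset.univ.erase a).erase a', g x) := by
    intro g
    rw [Finset.add_sum_erase _ g (by simp [hne.symm]), Finset.add_sum_erase _ g (by simp)]
  rw [hs, hs (fun x => f x * V x)] at hmax
  have hrest : ∑ x ∈ (Finset.univ.erase a).erase a', f (Equiv.swap a a' x) * V x =
      ∑ x ∈ (Finset.univ.erase a).erase a', f x * V x := by
    refine Finset.sum_congr rfl fun x hx => ?_
    simp only [Finset.mem_erase, Finset.mem_univ, and_true] at hx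
    rw [Equiv.swap_apply_of_ne_of_ne hx.2 hx.1]
  simp only [hrest, Equiv.swap_apply_left, Equiv.swap_apply_right] at hmax
  by_contra hlt
  push Not at hlt
  nlinarith

-- The sums are the rows read as binary numbers, whose order is the colexicographic order of their
-- supports. The witness is the last column at which the rows differ.
open Classical in
theorem rowsColex_of_sum_le {α β : Type*} [Fintype β] (R : α → β → Prop)
    (ρ : α → ℕ) (κ : β → ℕ) (hκ : Function.Injective κ)
    (h : ∀ a a', ρ a < ρ a' →
      ∑ b, (if R a b then 2 ^ κ b else 0) ≤ ∑ b, (if R a' b then 2 ^ κ b else 0)) :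
    RowsColex R ρ κ := by
  intro a a' c haa hac hac'
  let S : α → Finset ℕ := fun x => (Finset.univ.filter (R x)).image κ
  have hS : ∀ x b, κ b ∈ S x ↔ R x b := by
    intro x b
    simp only [S, Finset.mem_image, Finset.mem_filter, Finset.mem_univ, true_and]
    exact ⟨fun ⟨y, hy, e⟩ => hκ e ▸ hy, fun hb => ⟨b, hb, rfl⟩⟩
  have hsum : ∀ x, ∑ b, (if R x b then 2 ^ κ b else 0) = ∑ i ∈ S x, 2 ^ i := by
    intro x
    rw [Finset.sum_image fun _ _ _ _ e => hκ e, Finset.sum_filter]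
  have hle := h a a' haa
  rw [hsum, hsum, Finset.geomSum_le_geomSum_iff_toColex_le_toColex le_rfl,
    Finset.Colex.toColex_le_toColex] at hle
  let D := Finset.univ.filter fun d => ¬ (R a d ↔ R a' d)
  have hD : ∀ d, d ∈ D ↔ ¬ (R a d ↔ R a' d) := fun d => by simp [D]
  obtain ⟨m, hm, hmax⟩ := D.exists_max_image κ ⟨c, by rw [hD]; tauto⟩
  have hma : ¬ R a m ∧ R a' m := by
    by_contra hcon
    have h1 : R a m ∧ ¬ R a' m := by rw [hD] at hm; tauto
    obtain ⟨b, hb, hb', hbm⟩ := hle ((hS a m).2 h1.1) (mt (hS a' m).1 h1.2)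
    obtain ⟨e, -, rfl⟩ := Finset.mem_image.1 hb
    rw [hS] at hb hb'
    have := hmax e (by rw [hD]; tauto)
    have hem : e = m := hκ (by omega)
    subst hem
    exact h1.2 hb
  refine ⟨m, ?_, hma.1, hma.2, fun d hd => ?_⟩
  · have := hmax c (by rw [hD]; tauto)
    refine lt_of_le_of_ne this fun e => ?_
    rw [hκ e] at hac
    exact hma.1 hac
  · by_contra hcon
    have := hmax d (by rw [hD]; exact hcon)
    omega

/-- Every finite relation has a doubly lexical ordering. -/
theorem exists_doubly_lexical {α β : Type*} [Finite α] [Finite β] (R : α → β → Prop) :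
    ∃ (ρ : α → ℕ) (κ : β → ℕ), Function.Injective ρ ∧ Function.Injective κ ∧
      RowsColex R ρ κ ∧ RowsColex (flip R) κ ρ := by
  classical
  have := Fintype.ofFinite α
  have := Fintype.ofFinite β
  -- A maximizer is doubly lexical: for fixed columns this is a weighted sum of the binary values of
  -- the rows, which no exchange of two rows may increase; likewise for columns.
  let Φ : (α ≃ Fin (Fintype.card α)) × (β ≃ Fin (Fintype.card β)) → ℕ := fun e =>
    ∑ a, ∑ b, if R a b then 2 ^ (e.1 a : ℕ) * 2 ^ (e.2 b : ℕ) else 0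
  have : Nonempty ((α ≃ Fin (Fintype.card α)) × (β ≃ Fin (Fintype.card β))) :=
    ⟨Fintype.equivFin α, Fintype.equivFin β⟩
  obtain ⟨⟨e, f⟩, hmax⟩ := Finite.exists_max Φ
  have hρ : Function.Injective fun a => (e a : ℕ) := Fin.val_injective.comp e.injective
  have hκ : Function.Injective fun b => (f b : ℕ) := Fin.val_injective.comp f.injective
  have e1 : ∀ e' f', Φ (e', f') =
      ∑ a, 2 ^ (e' a : ℕ) * ∑ b, if R a b then 2 ^ (f' b : ℕ) else 0 := by
    intro e' f'
    simp only [Φ, Finset.mul_sum, mul_ite, mul_zero]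
  have e2 : ∀ e' f', Φ (e', f') =
      ∑ b, 2 ^ (f' b : ℕ) * ∑ a, if R a b then 2 ^ (e' a : ℕ) else 0 := by
    intro e' f'
    simp only [Φ, Finset.mul_sum, mul_ite, mul_zero]
    rw [Finset.sum_comm]
    simp only [mul_comm]
  refine ⟨fun a => e a, fun b => f b, hρ, hκ, rowsColex_of_sum_le _ _ _ hκ ?_,
    rowsColex_of_sum_le _ _ _ hρ ?_⟩
  · intro a a' haa
    refine sum_mul_le_of_swap_maximal (fun x => 2 ^ (e x : ℕ))
      (fun x => ∑ b, if R x b then 2 ^ (f b : ℕ) else 0) a a'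
      (Nat.pow_lt_pow_right (by norm_num) haa) ?_
    have := hmax ((Equiv.swap a a').trans e, f)
    rw [e1, e1] at this
    simpa using this
  · intro a a' haa
    refine sum_mul_le_of_swap_maximal (fun x => 2 ^ (f x : ℕ))
      (fun x => ∑ b, if flip R x b then 2 ^ (e b : ℕ) else 0) a a'
      (Nat.pow_lt_pow_right (by norm_num) haa) ?_
    have := hmax (e, (Equiv.swap a a').trans f)
    rw [e2, e2] at this
    exact this

end DoublyLexical

/-! ### Γ-freeness from the absence of long induced cycles -/

/-- The rows `r i` and columns `c i` with `i < n` induce a path that starts at both ends of the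
edge between `r 0` and `c 0`, and both sequences increase. -/
structure IsBand {α β : Type*} (R : α → β → Prop) (ρ : α → ℕ) (κ : β → ℕ) (n : ℕ)
    (r : ℕ → α) (c : ℕ → β) : Prop where
  row_lt : ∀ i, i + 1 < n → ρ (r i) < ρ (r (i + 1))
  col_lt : ∀ i, i + 1 < n → κ (c i) < κ (c (i + 1))
  adj : ∀ i j, i < n → j < n → (R (r i) (c j) ↔ (i = 0 ∧ j = 0) ∨ i + 1 = j ∨ j + 1 = i)
  row_agree : ∀ i, i + 2 < n → ∀ d, κ (c (i + 2)) < κ d → (R (r i) d ↔ R (r (i + 1)) d)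
  col_agree : ∀ i, i + 2 < n → ∀ d, ρ (r (i + 2)) < ρ d → (R d (c i) ↔ R d (c (i + 1)))

/-- No rows and columns induce a cycle with `n ≥ 3` rows and `n` columns. -/
def NoInducedCycle {α β : Type*} (R : α → β → Prop) : Prop :=
  ∀ n, 3 ≤ n → ∀ (r : ℕ → α) (c : ℕ → β), ¬ ∀ i j, i < n → j < n →
    (R (r i) (c j) ↔ (i = 0 ∧ j = 0) ∨ (i + 1 = n ∧ j + 1 = n) ∨ i + 1 = j ∨ j + 1 = i)

section Band

variable {α β : Type*} {R : α → β → Prop} {ρ : α → ℕ} {κ : β → ℕ} {n : ℕ} {r : ℕ → α} {c : ℕ → β}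

theorem IsBand.flip (h : IsBand R ρ κ n r c) : IsBand (flip R) κ ρ n c r where
  row_lt := h.col_lt
  col_lt := h.row_lt
  adj i j hi hj := by rw [_root_.flip, h.adj j i hj hi]; tauto
  row_agree := h.col_agree
  col_agree := h.row_agree

theorem IsBand.monotone (h : IsBand R ρ κ n r c) {i j : ℕ} (hij : i ≤ j) (hj : j < n) :
    ρ (r i) + (j - i) ≤ ρ (r j) := by
  induction j, hij using Nat.le_induction with
  | base => omega
  | succ j hij ih => have := ih (by omega); have := h.row_lt j hj; omega

/-- The next column of a band. -/
theorem IsBand.exists_col (h : IsBand R ρ κ (n + 2) r c) (hR : RowsColex R ρ κ) :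
    ∃ d, κ (c (n + 1)) < κ d ∧ (∀ i, i ≤ n → ¬ R (r i) d) ∧ R (r (n + 1)) d ∧
      ∀ d', κ d < κ d' → (R (r n) d' ↔ R (r (n + 1)) d') := by
  obtain ⟨d, h1, h2, h3, h4⟩ := hR (r n) (r (n + 1)) (c (n + 1)) (h.row_lt n (by omega))
    ((h.adj n (n + 1) (by omega) (by omega)).2 (by omega))
    (fun hh => by have := (h.adj (n + 1) (n + 1) (by omega) (by omega)).1 hh; omega)
  refine ⟨d, h1, fun i hi => ?_, h3, h4⟩
  -- The column `d` lies beyond `c (i + 2)`, so `row_agree` carries non-adjacency from row `i + 1`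
  -- to row `i`.
  induction hi using Nat.decreasingInduction with
  | self => exact h2
  | of_succ i hi ih =>
    rw [h.row_agree i (by omega) d]
    · exact ih
    · have := h.flip.monotone (i := i + 2) (j := n + 1) (by omega) (by omega)
      omega

/-- The new column is the last one at which the two last rows differ, and dually for the new row.
These two are non-adjacent, since otherwise they would close an induced cycle. -/
theorem IsBand.extend (h : IsBand R ρ κ (n + 2) r c) (hR : RowsColex R ρ κ)
    (hC : RowsColex (_root_.flip R) κ ρ) (hcyc : NoInducedCycle R) :
    ∃ r' c', IsBand R ρ κ (n + 3) r' c' := by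
  obtain ⟨d, hd1, hd2, hd3, hd4⟩ := h.exists_col hR
  obtain ⟨e, he1, he2, he3, he4⟩ := h.flip.exists_col hC
  let r' : ℕ → α := fun i => if i < n + 2 then r i else e
  let c' : ℕ → β := fun i => if i < n + 2 then c i else d
  have hr : ∀ i, i < n + 2 → r' i = r i := fun i hi => if_pos hi
  have hc : ∀ i, i < n + 2 → c' i = c i := fun i hi => if_pos hi
  have hre : r' (n + 2) = e := if_neg (by omega)
  have hcd : c' (n + 2) = d := if_neg (by omega)
  have hadj : ∀ i j, i < n + 3 → j < n + 3 → ¬ (i = n + 2 ∧ j = n + 2) →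
      (R (r' i) (c' j) ↔ (i = 0 ∧ j = 0) ∨ i + 1 = j ∨ j + 1 = i) := by
    intro i j hi hj hij
    rcases Nat.lt_succ_iff_lt_or_eq.1 hi with hi | rfl <;>
      rcases Nat.lt_succ_iff_lt_or_eq.1 hj with hj | rfl
    · rw [hr i hi, hc j hj, h.adj i j hi hj]
    · rw [hr i hi, hcd]
      rcases Nat.lt_succ_iff_lt_or_eq.1 hi with hi' | rfl
      · have := hd2 i (by omega)
        simp only [this, false_iff]; omega
      · simp [hd3]
    · rw [hc j hj, hre]
      rcases Nat.lt_succ_iff_lt_or_eq.1 hj with hj' | rfl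
      · have : ¬ R e (c j) := he2 j (by omega)
        simp only [this, false_iff]; omega
      · have : R e (c (n + 1)) := he3
        simp [this]
    · omega
  have hed : ¬ R e d := by
    intro hed
    refine hcyc (n + 3) (by omega) r' c' fun i j hi hj => ?_
    by_cases hij : i = n + 2 ∧ j = n + 2
    · obtain ⟨rfl, rfl⟩ := hij
      simp [hre, hcd, hed]
    · rw [hadj i j hi hj hij]; omega
  refine ⟨r', c', ⟨fun i hi => ?_, fun i hi => ?_, fun i j hi hj => ?_, fun i hi => ?_,
    fun i hi => ?_⟩⟩
  · rcases Nat.lt_succ_iff_lt_or_eq.1 hi with hi' | hi'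
    · rw [hr _ (by omega), hr _ hi']; exact h.row_lt i hi'
    · obtain rfl : i = n + 1 := by omega
      rw [hr _ (by omega), hre]; exact he1
  · rcases Nat.lt_succ_iff_lt_or_eq.1 hi with hi' | hi'
    · rw [hc _ (by omega), hc _ hi']; exact h.col_lt i hi'
    · obtain rfl : i = n + 1 := by omega
      rw [hc _ (by omega), hcd]; exact hd1
  · by_cases hij : i = n + 2 ∧ j = n + 2
    · obtain ⟨rfl, rfl⟩ := hij
      simp [hre, hcd, hed]
    · exact hadj i j hi hj hij
  · rw [hr i (by omega), hr (i + 1) (by omega)]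
    rcases Nat.lt_succ_iff_lt_or_eq.1 hi with hi' | hi'
    · rw [hc _ hi']; exact h.row_agree i hi'
    · obtain rfl : i = n := by omega
      rw [hcd]; exact hd4
  · rw [hc i (by omega), hc (i + 1) (by omega)]
    rcases Nat.lt_succ_iff_lt_or_eq.1 hi with hi' | hi'
    · rw [hr _ hi']; exact h.col_agree i hi'
    · obtain rfl : i = n := by omega
      rw [hre]; exact he4

/-- A doubly lexical ordering of a relation without induced long cycles has no `Γ`. -/
theorem gamma_free_of_doubly_lexical [Finite α] (hR : RowsColex R ρ κ)
    (hC : RowsColex (flip R) κ ρ) (hcyc : NoInducedCycle R) {a a' : α} {b b' : β}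
    (ha : ρ a < ρ a') (hb : κ b < κ b') (h1 : R a b) (h2 : R a b') (h3 : R a' b) : R a' b' := by
  by_contra h4
  -- A Γ is a band of length two and would grow to every length, while the row positions strictly
  -- increase in a finite set.
  have key : ∀ n, ∃ r c, IsBand R ρ κ (n + 2) r c := by
    intro n
    induction n with
    | zero =>
      refine ⟨fun i => if i = 0 then a else a', fun i => if i = 0 then b else b',
        ⟨fun i hi => ?_, fun i hi => ?_, fun i j hi hj => ?_, fun i hi => by omega,
          fun i hi => by omega⟩⟩
      · obtain rfl : i = 0 := by omega
        simpa using ha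
      · obtain rfl : i = 0 := by omega
        simpa using hb
      · interval_cases i <;> interval_cases j <;> simp [h1, h2, h3, h4]
    | succ n ih =>
      obtain ⟨r, c, h⟩ := ih
      exact h.extend hR hC hcyc
  obtain ⟨M, hM⟩ := (Set.finite_range ρ).bddAbove
  obtain ⟨r, c, h⟩ := key M
  have h5 := h.monotone (i := 0) (j := M + 1) (by omega) (by omega)
  have h6 := hM ⟨r (M + 1), rfl⟩
  omega

end Band

/-! ### Interaction of the first rows at which a row is altered -/

/-- A relation between ordered rows and columns without the submatrix `Γ`. -/
def GammaFree {α β : Type*} [LinearOrder α] [LinearOrder β] (R : α → β → Prop) : Prop :=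
  ∀ ⦃a a' : α⦄ ⦃b b' : β⦄, a < a' → b < b' → R a b → R a b' → R a' b → R a' b'

/-- The bipartite form of `D_k`-freeness, with the vertices `v₂`, `v₄` and the pendant neighbour of
`v₁` among the rows. -/
def PendantSquareFree {α β : Type*} (k : ℕ) (R : α → β → Prop) : Prop :=
  ∀ (u v z : α) (i j p : β) (T : Finset β), R u i → R v i → R z i → R u j → R v j → ¬ R z j →
    R u p → ¬ R v p → ¬ R z p → (∀ q ∈ T, R v q ∧ ¬ R u q ∧ ¬ R z q) → T.card < k

/-- The row `u` survives the passage from the subrelation on `A × B` to the one on `A' × B'`, in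
which `w` is the first row of `A`, and its restriction to the row `w` is altered there. -/
structure IsSplit {α β : Type*} [LinearOrder α] (k : ℕ) (R : α → β → Prop) [DecidableRel R]
    (A A' : Finset α) (B B' : Finset β) (w u : α) : Prop where
  mem : w ∈ A
  min : ∀ x ∈ A, w ≤ x
  row : u ∈ A'
  row_sub : A' ⊆ A
  twin_free : ∀ b ∈ B, ∀ b' ∈ B, b ≠ b' → ∃ z ∈ A, ¬ (R z b ↔ R z b')
  missed : k + 2 ≤ (B.filter fun b => R w b ∧ ¬ R u b).card
  shared : k + 2 ≤ (B.filter fun b => R w b ∧ R u b).card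
  outside : k + 3 < (B.filter fun b => R u b ∧ ¬ R w b).card
  missed_le : (B'.filter fun b => R w b ∧ ¬ R u b).card ≤ k + 3
  shared_le : (B'.filter fun b => R w b ∧ R u b).card ≤ k + 3
  small : (B'.filter fun b => R w b ∧ ¬ R u b).card ≤ k + 1 ∨
    (B'.filter fun b => R w b ∧ R u b).card ≤ k + 1
  missed_del : ∃ b ∈ B, R w b ∧ ¬ R u b ∧ b ∉ B'
  shared_del : ∃ b ∈ B, R w b ∧ R u b ∧ b ∉ B'

theorem IsSplit.le {α β : Type*} [LinearOrder α] {k : ℕ}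
    {R : α → β → Prop} [DecidableRel R] {A A' : Finset α} {B B' : Finset β} {w u : α}
    (h : IsSplit k R A A' B B' w u) : w ≤ u := h.min u (h.row_sub h.row)

theorem IsSplit.exists_shared {α β : Type*} [LinearOrder α] {k : ℕ}
    {R : α → β → Prop} [DecidableRel R] {A A' : Finset α} {B B' : Finset β} {w u : α}
    (h : IsSplit k R A A' B B' w u) : ∃ b ∈ B, R w b ∧ R u b := by
  obtain ⟨b, hb, h1, h2, -⟩ := h.shared_del
  exact ⟨b, hb, h1, h2⟩

section Core

variable {α β : Type*} [LinearOrder α] [LinearOrder β] {k : ℕ} {R : α → β → Prop}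

/-- The rows after `w` meet the row `w` in final segments. -/
theorem GammaFree.final (hΓ : GammaFree R) {w u : α} (hwu : w ≤ u) {b b' : β} (hb : b ≤ b')
    (h1 : R w b) (h2 : R w b') (h3 : R u b) : R u b' := by
  rcases hwu.eq_or_lt with rfl | hwu
  · exact h2
  rcases hb.eq_or_lt with rfl | hb
  · exact h3
  · exact hΓ hwu hb h1 h2 h3

/-- There is no induced cycle of length six. -/
theorem GammaFree.no_hexagon (hΓ : GammaFree R) {x y z : α} {a b c : β}
    (xa : ¬ R x a) (xb : R x b) (xc : R x c) (ya : R y a) (yb : ¬ R y b) (yc : R y c)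
    (za : R z a) (zb : R z b) (zc : ¬ R z c) : False := by
  -- If `x` is the earliest row, the final-segment property fails at `b` and `c`. The other orders
  -- permute the roles.
  have key : ∀ {x y z : α} {a b c : β}, ¬ R x a → R x b → R x c → R y a → ¬ R y b → R y c →
      R z a → R z b → ¬ R z c → x ≤ y → x ≤ z → False := by
    intro x y z a b c xa xb xc ya yb yc za zb zc hy hz
    rcases le_total b c with h | h
    · exact zc (hΓ.final hz h xb xc zb)
    · exact yb (hΓ.final hy h xc xb yc)
  rcases le_total x y with h1 | h1 <;> rcases le_total y z with h2 | h2 <;>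
    rcases le_total x z with h3 | h3
  · exact key xa xb xc ya yb yc za zb zc h1 h3
  · exact key xa xb xc ya yb yc za zb zc h1 (h1.trans h2)
  · exact key xa xb xc ya yb yc za zb zc h1 h3
  · exact key zc za zb xc xa xb yc ya yb h3 h2
  · exact key yb ya yc xb xa xc zb za zc h1 h2
  · exact key yb ya yc xb xa xc zb za zc h1 h2
  · exact key xa xb xc ya yb yc za zb zc (h3.trans h2) h3
  · exact key zc za zb xc xa xb yc ya yb h3 h2

/-- A row that meets the first row `w` in a proper part of what `u` meets contains all that `u` has
outside `w`, if `u` misses at least `k` elements of `w`. -/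
theorem outside_subset_of_shrinks (hΓ : GammaFree R) (hD : PendantSquareFree k R) {w u z : α}
    (hu : w ≤ u) (hz : w ≤ z) {T : Finset β} (hT : ∀ q ∈ T, R w q ∧ ¬ R u q) (hk : k ≤ T.card)
    {y y' : β} (hy : R w y) (hy1 : R u y) (hy2 : ¬ R z y) (hy' : R w y') (hy1' : R z y')
    {p : β} (hp : R u p) (hp' : ¬ R w p) : R z p := by
  by_contra hzp
  -- Final segments of `w` are nested, and `z` misses the element `y` of `u`.
  have hsub : ∀ q, R w q → R z q → R u q := by
    intro q hq hzq
    rcases le_total y q with h | h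
    · exact hΓ.final hu h hy hq hy1
    · exact absurd (hΓ.final hz h hq hy hzq) hy2
  -- A copy of `D_k`: the square `y'`, `u`, `y`, `w` with pendants `z` at `y'`, `p` at `u`, and `T`
  -- at `w`.
  refine absurd (hD u w z y' y p T (hsub y' hy' hy1') hy' hy1' hy1 hy hy2 hp hp' hzp
    fun q hq => ⟨(hT q hq).1, (hT q hq).2, fun h => (hT q hq).2 (hsub q (hT q hq).1 h)⟩) (by omega)

variable [DecidableRel R]

/-- If the row `u` is altered at two places, then the two first rows are disjoint or the later one
continues the earlier one in at most one direction. -/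
theorem IsSplit.disjoint_or {A₁ A₁' A₂ A₂' : Finset α} {B₁ B₁' B₂ B₂' : Finset β} {w₁ w₂ u : α}
    (hΓ : GammaFree R) (hD : PendantSquareFree k R)
    (h₁ : IsSplit k R A₁ A₁' B₁ B₁' w₁ u) (h₂ : IsSplit k R A₂ A₂' B₂ B₂' w₂ u)
    (hA : A₂ ⊆ A₁') (hB : B₂ ⊆ B₁') :
    (∀ b, R w₁ b → ¬ R w₂ b) ∨ (∀ b, R w₁ b → R u b → R w₂ b) ∧
      ((∀ b ∈ B₂, R w₂ b → R u b → R w₁ b) ∨ (∀ b ∈ B₂, R w₂ b → ¬ R u b → R w₁ b)) := by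
  by_cases hdis : ∀ b, R w₁ b → ¬ R w₂ b
  · exact Or.inl hdis
  right
  push Not at hdis
  obtain ⟨y', hy1, hy2⟩ := hdis
  have hw : w₁ ≤ w₂ := h₁.min _ (h₁.row_sub (hA h₂.mem))
  have hsub : ∀ b, R w₁ b → R u b → R w₂ b := by
    by_contra hcon
    push Not at hcon
    obtain ⟨y, hy, hy3, hy4⟩ := hcon
    have hout : ∀ p, R u p → ¬ R w₁ p → R w₂ p := fun p hp hp' =>
      outside_subset_of_shrinks hΓ hD h₁.le hw
        (T := B₁.filter fun b => R w₁ b ∧ ¬ R u b) (by simp +contextual)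
        (by have := h₁.missed; omega) hy hy3 hy4 hy1 hy2 hp hp'
    -- All that `u` has outside `w₁` lies in `w₂`, so what remains of `u` outside `w₂` was shared
    -- with `w₁`: at most `k + 3` elements, against `outside`.
    have hss : (B₂.filter fun b => R u b ∧ ¬ R w₂ b) ⊆ B₁'.filter fun b => R w₁ b ∧ R u b := by
      intro b hb
      rw [Finset.mem_filter] at hb ⊢
      exact ⟨hB hb.1, by_contra fun h => hb.2.2 (hout b hb.2.1 h), hb.2.1⟩
    have := Finset.card_le_card hss
    have := h₂.outside
    have := h₁.shared_le
    omega
  refine ⟨hsub, ?_⟩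
  by_contra hcon
  push Not at hcon
  obtain ⟨⟨j, hjB, hj1, hj2, hj3⟩, ⟨p, hpB, hp1, hp2, hp3⟩⟩ := hcon
  obtain ⟨i, -, hi1, hi2⟩ := h₁.exists_shared
  -- The square `i`, `w₂`, `j`, `u` with pendants `w₁` at `i`, `p` at `w₂`, and the elements of `u`
  -- outside `w₂` at `u`.
  have := hD w₂ u w₁ i j p (B₂.filter fun b => R u b ∧ ¬ R w₂ b) (hsub i hi1 hi2) hi2 hi1
    hj1 hj2 hj3 hp1 hp2 hp3 (by
      intro q hq
      rw [Finset.mem_filter] at hq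
      exact ⟨hq.2.1, hq.2.2, fun h => hq.2.2 (hsub q h hq.2.1)⟩)
  have := h₂.outside
  omega

/-- Some row separates two elements that `u` shares with the first row `w`, and contains all that
`u` has outside `w`. -/
theorem IsSplit.exists_separating {A A' : Finset α} {B B' : Finset β} {w u : α}
    (hΓ : GammaFree R) (hD : PendantSquareFree k R) (h : IsSplit k R A A' B B' w u) :
    ∃ z b, R w b ∧ R u b ∧ ¬ R z b ∧ ∀ p, R u p → ¬ R w p → R z p := by
  obtain ⟨b, hb, b', hb', hne⟩ := Finset.one_lt_card.1
    (show 1 < (B.filter fun b => R w b ∧ R u b).card by have := h.shared; omega)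
  rw [Finset.mem_filter] at hb hb'
  obtain ⟨z, hz, hzb⟩ := h.twin_free b hb.1 b' hb'.1 hne
  have key : ∀ b b', R w b → R u b → R w b' → R z b' → ¬ R z b →
      ∃ z b, R w b ∧ R u b ∧ ¬ R z b ∧ ∀ p, R u p → ¬ R w p → R z p := by
    intro b b' h1 h2 h3 h4 h5
    exact ⟨z, b, h1, h2, h5, fun p hp hp' => outside_subset_of_shrinks hΓ hD h.le (h.min z hz)
      (T := B.filter fun b => R w b ∧ ¬ R u b) (by simp +contextual)
      (by have := h.missed; omega) h1 h2 h5 h3 h4 hp hp'⟩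
  by_cases hzb1 : R z b
  · exact key b' b hb'.2.1 hb'.2.2 hb.2.1 hzb1 (by tauto)
  · exact key b b' hb.2.1 hb.2.2 hb'.2.1 (by tauto) hzb1

/-- The separating row `zᵢ` misses `bᵢ` but contains the other two `bⱼ`, which lie in `u` outside
`wᵢ`. This is a hexagon. -/
theorem IsSplit.not_disjoint_triple {A₁ A₁' A₂ A₂' A₃ A₃' : Finset α}
    {B₁ B₁' B₂ B₂' B₃ B₃' : Finset β} {w₁ w₂ w₃ u : α}
    (hΓ : GammaFree R) (hD : PendantSquareFree k R)
    (h₁ : IsSplit k R A₁ A₁' B₁ B₁' w₁ u) (h₂ : IsSplit k R A₂ A₂' B₂ B₂' w₂ u)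
    (h₃ : IsSplit k R A₃ A₃' B₃ B₃' w₃ u) (h12 : ∀ b, R w₁ b → ¬ R w₂ b)
    (h13 : ∀ b, R w₁ b → ¬ R w₃ b) (h23 : ∀ b, R w₂ b → ¬ R w₃ b) : False := by
  obtain ⟨z₁, b₁, w1, u1, n1, o1⟩ := h₁.exists_separating hΓ hD
  obtain ⟨z₂, b₂, w2, u2, n2, o2⟩ := h₂.exists_separating hΓ hD
  obtain ⟨z₃, b₃, w3, u3, n3, o3⟩ := h₃.exists_separating hΓ hD
  exact hΓ.no_hexagon n1 (o1 b₂ u2 fun h => h12 _ h w2) (o1 b₃ u3 fun h => h13 _ h w3)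
    (o2 b₁ u1 (h12 _ w1)) n2 (o2 b₃ u3 fun h => h23 _ h w3)
    (o3 b₁ u1 (h13 _ w1)) (o3 b₂ u2 (h23 _ w2)) n3

end Core

/-! ### Counting the alterations of a row -/

/-- A set of size `k + 3` cannot contain three sets of size `k + 2` from a decreasing sequence that
loses an element of each of them. -/
theorem false_of_three_deletions {β : Type*} [DecidableEq β] {k : ℕ} {B : ℕ → Finset β}
    (hB : Antitone B) {X S₁ S₂ S₃ : Finset β} {i j l : ℕ} (hij : i < j) (hjl : j < l)
    (hX : X.card ≤ k + 3) (h₁ : S₁ ⊆ X) (h₂ : S₂ ⊆ X) (h₃ : S₃ ⊆ X) (h₂B : S₂ ⊆ B j)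
    (h₃B : S₃ ⊆ B l) (hc : k + 2 ≤ S₃.card) (d₁ : ∃ b ∈ S₁, b ∉ B (i + 1))
    (d₂ : ∃ b ∈ S₂, b ∉ B (j + 1)) : False := by
  obtain ⟨b₁, hb₁, hn₁⟩ := d₁
  obtain ⟨b₂, hb₂, hn₂⟩ := d₂
  have hne : b₁ ≠ b₂ := fun e => hn₁ (hB (show i + 1 ≤ j from hij) (h₂B (e ▸ hb₂)))
  have hs : S₃ ⊆ (X.erase b₁).erase b₂ := by
    intro b hb
    rw [Finset.mem_erase, Finset.mem_erase]
    refine ⟨?_, ?_, h₃ hb⟩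
    · rintro rfl
      exact hn₂ (hB (show j + 1 ≤ l from hjl) (h₃B hb))
    · rintro rfl
      exact hn₁ (hB (show i + 1 ≤ l by omega) (h₃B hb))
  have hcard := Finset.card_le_card hs
  rw [Finset.card_erase_of_mem (Finset.mem_erase.2 ⟨hne.symm, h₂ hb₂⟩),
    Finset.card_erase_of_mem (h₁ hb₁)] at hcard
  omega

section Count

variable {α β : Type*} [LinearOrder α] [LinearOrder β] {k : ℕ} {R : α → β → Prop} [DecidableRel R]
  {A : ℕ → Finset α} {B : ℕ → Finset β} {w : ℕ → α} {u : α}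

-- Of the shared and the missed part left of `w i`, one has at most `k + 1` elements, too few for a
-- later alteration, which needs `k + 2` in each of its parts. So all continuations draw on the
-- other part, of size at most `k + 3`, and each deletes an element of it.
omit [LinearOrder β] in
theorem card_continuing_le (hB : Antitone B) {E : Finset ℕ} {i : ℕ}
    (hi : IsSplit k R (A i) (A (i + 1)) (B i) (B (i + 1)) (w i) u)
    (hE : ∀ j ∈ E, i < j ∧ IsSplit k R (A j) (A (j + 1)) (B j) (B (j + 1)) (w j) u ∧
      ((∀ b ∈ B j, R (w j) b → R u b → R (w i) b) ∨
        (∀ b ∈ B j, R (w j) b → ¬ R u b → R (w i) b))) : E.card ≤ 2 := by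
  classical
  by_contra hcard
  push Not at hcard
  let f := E.orderEmbOfCardLe (show 3 ≤ E.card from hcard)
  have hf : ∀ x, f x ∈ E := E.orderEmbOfCardLe_mem hcard
  have h01 : f 0 < f 1 := f.strictMono (by decide)
  have h12 : f 1 < f 2 := f.strictMono (by decide)
  have hBi : ∀ j ∈ E, B j ⊆ B (i + 1) := fun j hj => hB (hE j hj).1
  rcases hi.small with hs | hs
  · have hsub : ∀ j ∈ E, ((B j).filter fun b => R (w j) b ∧ R u b) ⊆
        (B (i + 1)).filter fun b => R (w i) b ∧ R u b := by
      intro j hj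
      obtain ⟨-, hsj, h | h⟩ := hE j hj
      · intro b hb
        rw [Finset.mem_filter] at hb ⊢
        exact ⟨hBi j hj hb.1, h b hb.1 hb.2.1 hb.2.2, hb.2.2⟩
      · have hss : ((B j).filter fun b => R (w j) b ∧ ¬ R u b) ⊆
            (B (i + 1)).filter fun b => R (w i) b ∧ ¬ R u b := by
          intro b hb
          rw [Finset.mem_filter] at hb ⊢
          exact ⟨hBi j hj hb.1, h b hb.1 hb.2.1 hb.2.2, hb.2.2⟩
        have := Finset.card_le_card hss
        have := hsj.missed
        omega
    have hdel : ∀ j ∈ E, ∃ b ∈ (B j).filter fun b => R (w j) b ∧ R u b, b ∉ B (j + 1) := by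
      intro j hj
      obtain ⟨b, hb, h1, h2, h3⟩ := (hE j hj).2.1.shared_del
      exact ⟨b, Finset.mem_filter.2 ⟨hb, h1, h2⟩, h3⟩
    exact false_of_three_deletions hB h01 h12 hi.shared_le (hsub _ (hf 0)) (hsub _ (hf 1))
      (hsub _ (hf 2)) (Finset.filter_subset _ _) (Finset.filter_subset _ _)
      (hE _ (hf 2)).2.1.shared (hdel _ (hf 0)) (hdel _ (hf 1))
  · have hsub : ∀ j ∈ E, ((B j).filter fun b => R (w j) b ∧ ¬ R u b) ⊆
        (B (i + 1)).filter fun b => R (w i) b ∧ ¬ R u b := by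
      intro j hj
      obtain ⟨-, hsj, h | h⟩ := hE j hj
      · have hss : ((B j).filter fun b => R (w j) b ∧ R u b) ⊆
            (B (i + 1)).filter fun b => R (w i) b ∧ R u b := by
          intro b hb
          rw [Finset.mem_filter] at hb ⊢
          exact ⟨hBi j hj hb.1, h b hb.1 hb.2.1 hb.2.2, hb.2.2⟩
        have := Finset.card_le_card hss
        have := hsj.shared
        omega
      · intro b hb
        rw [Finset.mem_filter] at hb ⊢
        exact ⟨hBi j hj hb.1, h b hb.1 hb.2.1 hb.2.2, hb.2.2⟩
    have hdel : ∀ j ∈ E, ∃ b ∈ (B j).filter fun b => R (w j) b ∧ ¬ R u b, b ∉ B (j + 1) := by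
      intro j hj
      obtain ⟨b, hb, h1, h2, h3⟩ := (hE j hj).2.1.missed_del
      exact ⟨b, Finset.mem_filter.2 ⟨hb, h1, h2⟩, h3⟩
    exact false_of_three_deletions hB h01 h12 hi.missed_le (hsub _ (hf 0)) (hsub _ (hf 1))
      (hsub _ (hf 2)) (Finset.filter_subset _ _) (Finset.filter_subset _ _)
      (hE _ (hf 2)).2.1.missed (hdel _ (hf 0)) (hdel _ (hf 1))

/-- Along an elimination, every row is altered at most six times. -/
theorem card_split_le (hΓ : GammaFree R) (hD : PendantSquareFree k R) (hA : Antitone A)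
    (hB : Antitone B) {E : Finset ℕ}
    (hE : ∀ i ∈ E, IsSplit k R (A i) (A (i + 1)) (B i) (B (i + 1)) (w i) u) : E.card ≤ 6 := by
  classical
  let dis : ℕ → ℕ → Prop := fun i j => ∀ b, R (w i) b → ¬ R (w j) b
  have hcont : ∀ i ∈ E, (E.filter fun j => i < j ∧ ¬ dis i j).card ≤ 2 := by
    intro i hi
    refine card_continuing_le hB (hE i hi) fun j hj => ?_
    rw [Finset.mem_filter] at hj
    refine ⟨hj.2.1, hE j hj.1, ?_⟩
    rcases (hE i hi).disjoint_or hΓ hD (hE j hj.1) (hA hj.2.1) (hB hj.2.1) with h | h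
    · exact absurd h hj.2.2
    · exact h.2
  rcases E.eq_empty_or_nonempty with rfl | hne
  · simp
  let i := E.min' hne
  have hi : i ∈ E := E.min'_mem hne
  -- The count is `1 + 2 + (1 + 2)`: the first alteration, those not disjoint from it, then the
  -- first disjoint one and those not disjoint from that.
  let E' := E.filter fun j => i < j ∧ dis i j
  have hEE : E ⊆ {i} ∪ (E.filter fun j => i < j ∧ ¬ dis i j) ∪ E' := by
    intro j hj
    have hle : i ≤ j := E.min'_le j hj
    simp only [Finset.mem_union, Finset.mem_singleton, Finset.mem_filter, E']
    rcases hle.eq_or_lt with h | h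
    · exact Or.inl (Or.inl h.symm)
    · by_cases hd : dis i j <;> tauto
  have hc1 := Finset.card_le_card hEE
  have hc2 := Finset.card_union_le ({i} ∪ (E.filter fun j => i < j ∧ ¬ dis i j)) E'
  have hc3 := Finset.card_union_le {i} (E.filter fun j => i < j ∧ ¬ dis i j)
  have hc4 := hcont i hi
  rw [Finset.card_singleton] at hc3
  suffices hE' : E'.card ≤ 3 by omega
  rcases E'.eq_empty_or_nonempty with he | hne'
  · simp [he]
  let j := E'.min' hne'
  have hj : j ∈ E' := E'.min'_mem hne'
  have hj' := Finset.mem_filter.1 hj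
  have hEE' : E' ⊆ {j} ∪ (E.filter fun l => j < l ∧ ¬ dis j l) := by
    intro l hl
    have hle : j ≤ l := E'.min'_le l hl
    have hl' := Finset.mem_filter.1 hl
    simp only [Finset.mem_union, Finset.mem_singleton, Finset.mem_filter]
    rcases hle.eq_or_lt with h | h
    · exact Or.inl h.symm
    · refine Or.inr ⟨hl'.1, h, fun hd => ?_⟩
      exact (hE i hi).not_disjoint_triple hΓ hD (hE j hj'.1) (hE l hl'.1) hj'.2.2 hl'.2.2 hd
  have hc5 := Finset.card_le_card hEE'
  have hc6 := Finset.card_union_le {j} (E.filter fun l => j < l ∧ ¬ dis j l)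
  have hc7 := hcont j hj'.1
  rw [Finset.card_singleton] at hc6
  omega

end Count

/-! ### The elimination and the enumeration of the columns -/

/-- Four elements of a large finite set: `c₁ < c₂ < c₃` are consecutive with `a` elements below
`c₁`, and `a` elements lie above `c₄`. -/
theorem exists_cuts {β : Type*} [LinearOrder β] (Y : Finset β) (a : ℕ) (h : 2 * a + 4 ≤ Y.card) :
    ∃ c₁ ∈ Y, ∃ c₂ ∈ Y, ∃ c₃ ∈ Y, ∃ c₄ ∈ Y, c₁ < c₂ ∧ c₂ < c₃ ∧ c₃ < c₄ ∧
      (Y.filter (· < c₁)).card = a ∧ (Y.filter (c₄ < ·)).card = a ∧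
      (∀ y ∈ Y, y < c₂ → y ≤ c₁) ∧ ∀ y ∈ Y, y < c₃ → y ≤ c₂ := by
  obtain ⟨m, hm⟩ : ∃ m, Y.card = m := ⟨_, rfl⟩
  let e := Y.orderEmbOfFin hm
  have he : ∀ i, e i ∈ Y := Y.orderEmbOfFin_mem hm
  have hY : Y = Finset.univ.map e.toEmbedding := by
    ext y
    have := Y.range_orderEmbOfFin hm
    rw [Set.ext_iff] at this
    rw [Finset.mem_map]
    exact ⟨fun h => let ⟨i, hi⟩ := (this y).2 h; ⟨i, Finset.mem_univ i, hi⟩,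
      fun ⟨i, _, hi⟩ => (this y).1 ⟨i, hi⟩⟩
  have hsurj : ∀ y ∈ Y, ∃ i, e i = y := by
    intro y hy
    rw [hY] at hy
    simpa using hy
  refine ⟨e ⟨a, by omega⟩, he _, e ⟨a + 1, by omega⟩, he _, e ⟨a + 2, by omega⟩, he _,
    e ⟨m - 1 - a, by omega⟩, he _, by simp [Fin.lt_def], by simp [Fin.lt_def],
    by simp [Fin.lt_def]; omega, ?_, ?_, ?_, ?_⟩
  · have : Y.filter (· < e ⟨a, by omega⟩) = (Finset.Iio ⟨a, by omega⟩).map e.toEmbedding := by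
      ext y
      simp only [Finset.mem_filter, Finset.mem_map, Finset.mem_Iio, RelEmbedding.coe_toEmbedding]
      constructor
      · rintro ⟨hy, hlt⟩
        obtain ⟨i, rfl⟩ := hsurj y hy
        exact ⟨i, e.lt_iff_lt.1 hlt, rfl⟩
      · rintro ⟨i, hi, rfl⟩
        exact ⟨he i, e.lt_iff_lt.2 hi⟩
    rw [this, Finset.card_map, Fin.card_Iio]
  · have : Y.filter (e ⟨m - 1 - a, by omega⟩ < ·) =
        (Finset.Ioi ⟨m - 1 - a, by omega⟩).map e.toEmbedding := by
      ext y
      simp only [Finset.mem_filter, Finset.mem_map, Finset.mem_Ioi, RelEmbedding.coe_toEmbedding]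
      constructor
      · rintro ⟨hy, hlt⟩
        obtain ⟨i, rfl⟩ := hsurj y hy
        exact ⟨i, e.lt_iff_lt.1 hlt, rfl⟩
      · rintro ⟨i, hi, rfl⟩
        exact ⟨he i, e.lt_iff_lt.2 hi⟩
    rw [this, Finset.card_map, Fin.card_Ioi]
    simp only; omega
  · intro y hy hlt
    obtain ⟨i, rfl⟩ := hsurj y hy
    rw [e.lt_iff_lt, Fin.lt_def] at hlt
    rw [e.le_iff_le, Fin.le_def]
    simp only at hlt ⊢; omega
  · intro y hy hlt
    obtain ⟨i, rfl⟩ := hsurj y hy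
    rw [e.lt_iff_lt, Fin.lt_def] at hlt
    rw [e.le_iff_le, Fin.le_def]
    simp only at hlt ⊢; omega

/-- The list `l` enumerates the finite set `B` without repetition. -/
def Enumerates {β : Type*} (l : List β) (B : Finset β) : Prop :=
  l.Nodup ∧ ∀ b, b ∈ l ↔ b ∈ B

/-- A reduction of the subrelation on `A × B` to the one on `A' × B'` that allows an enumeration of
`B'` to be extended to one of `B` at bounded cost for the rows. -/
structure IsReduction {α β : Type*} [LinearOrder α] (k : ℕ) (R : α → β → Prop) [DecidableRel R]
    (A A' : Finset α) (B B' : Finset β) : Prop where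
  row_sub : A' ⊆ A
  col_sub : B' ⊆ B
  card_lt : A.Nonempty → A'.card + B'.card < A.card + B.card
  lift : ∀ l', Enumerates l' B' → ∃ l, Enumerates l B ∧ ∀ u ∈ A,
    (u ∉ A' → variation (R u) l ≤ 6 * k + 18) ∧
    (u ∈ A' → variation (R u) l ≤ variation (R u) l' + 4) ∧
    (u ∈ A' → (∀ w, ¬ IsSplit k R A A' B B' w u) → variation (R u) l ≤ variation (R u) l')

theorem Enumerates.insert_after {β : Type*} [DecidableEq β] {l : List β} {B B' : Finset β}
    (hl : Enumerates l B) {c : β} (hc : c ∈ B) {ys : List β} (hys : ys.Nodup)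
    (hdis : ∀ y ∈ ys, y ∉ B) (hB' : ∀ b, b ∈ B' ↔ b ∈ ys ∨ b ∈ B) :
    ∃ l', Enumerates l' B' ∧
      ∀ p : β → Prop, variation p l' ≤ variation p l + 2 * variation p (c :: ys) := by
  obtain ⟨l', hperm, hvar⟩ := exists_insert_after l c ((hl.2 c).2 hc) ys
  refine ⟨l', ⟨?_, fun b => ?_⟩, hvar⟩
  · rw [hperm.nodup_iff, List.nodup_append]
    refine ⟨hys, hl.1, fun a ha b hb hab => ?_⟩
    subst hab
    exact hdis a ha ((hl.2 a).1 hb)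
  · rw [hperm.mem_iff, List.mem_append, hl.2, hB']

theorem Enumerates.variation_le {β : Type*} {l : List β} {B : Finset β}
    (hl : Enumerates l B) (p : β → Prop) [DecidablePred p] :
    variation p l ≤ 2 * (B.filter p).card := by
  classical
  refine (variation_le_countP p l).trans ?_
  rw [List.countP_eq_length_filter]
  have h : (l.filter fun x => p x).toFinset = B.filter p := by
    ext b
    simp [hl.2]
  rw [← h, List.toFinset_card_of_nodup (hl.1.filter _)]
  apply le_of_eq
  congr!

section Reductions

variable {α β : Type*} [LinearOrder α] [LinearOrder β] {k : ℕ} {R : α → β → Prop} [DecidableRel R]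
  {A : Finset α} {B : Finset β}

theorem isReduction_of_twins {b b' : β} (hb : b ∈ B) (hb' : b' ∈ B) (hne : b ≠ b')
    (htwin : ∀ z ∈ A, R z b ↔ R z b') : IsReduction k R A A B (B.erase b) where
  row_sub := subset_rfl
  col_sub := B.erase_subset b
  card_lt _ := by have := Finset.card_erase_lt_of_mem hb; omega
  lift l' hl' := by
    obtain ⟨l, hl, hvar⟩ := hl'.insert_after (B' := B) (c := b')
      (Finset.mem_erase.2 ⟨hne.symm, hb'⟩) (List.nodup_singleton b) (by simp) (fun x => by
        by_cases hx : x = b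
        · subst hx; simpa using hb
        · simp [hx])
    have h : ∀ u ∈ A, variation (R u) l ≤ variation (R u) l' := by
      intro u hu
      have := hvar (R u)
      simpa [variation, htwin u hu] using this
    exact ⟨l, hl, fun u hu => ⟨fun h' => absurd hu h', fun _ => (h u hu).trans (by omega),
      fun _ _ => h u hu⟩⟩

omit [LinearOrder β] in
theorem isReduction_of_small_row {w : α} (hw : w ∈ A)
    (hsmall : (B.filter (R w)).card ≤ 2 * k + 5) : IsReduction k R A (A.erase w) B B where
  row_sub := A.erase_subset w
  col_sub := subset_rfl
  card_lt _ := by have := Finset.card_erase_lt_of_mem hw; omega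
  lift l' hl' := by
    refine ⟨l', hl', fun u hu => ⟨fun h => ?_, fun _ => by omega, fun _ _ => le_rfl⟩⟩
    have huw : u = w := by
      by_contra hne
      exact h (Finset.mem_erase.2 ⟨hne, hu⟩)
    subst huw
    -- At most `2k + 5` members give at most `4k + 10` changes, which is within `6k + 18`.
    have := hl'.variation_le (R u)
    omega

theorem isReduction_of_large_row (hΓ : GammaFree R) {w : α} (hw : w ∈ A) (hmin : ∀ x ∈ A, w ≤ x)
    (htwin : ∀ b ∈ B, ∀ b' ∈ B, b ≠ b' → ∃ z ∈ A, ¬ (R z b ↔ R z b'))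
    (hlarge : 2 * k + 6 ≤ (B.filter (R w)).card) :
    ∃ A' B', IsReduction k R A A' B B' := by
  obtain ⟨c₁, h₁, c₂, h₂, c₃, h₃, c₄, h₄, h12, h23, h34, hlow, htop, hc₂, hc₃⟩ :=
    exists_cuts (B.filter (R w)) (k + 1) (by omega)
  set Y := B.filter (R w) with hY
  have hmY : ∀ y, y ∈ Y ↔ y ∈ B ∧ R w y := fun y => by rw [hY, Finset.mem_filter]
  let A' := A.filter fun u => k + 3 < (B.filter fun b => R u b ∧ ¬ R w b).card
  -- Of the row `w` there remain `k + 1` elements below `c₁`, the anchors `c₂` and `c₃`, and `k + 1`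
  -- elements above `c₄`. Later `c₁` returns after `c₂`, and the interval from `c₃` to `c₄` after
  -- `c₃`.
  let B' := B.filter fun b => ¬ (R w b ∧ (b = c₁ ∨ (c₃ < b ∧ b ≤ c₄)))
  have hmB' : ∀ b, b ∈ B' ↔ b ∈ B ∧ ¬ (R w b ∧ (b = c₁ ∨ (c₃ < b ∧ b ≤ c₄))) := fun b => by
    simp only [B', Finset.mem_filter]
  have hfin : ∀ u ∈ A, ∀ b ∈ Y, ∀ b' ∈ Y, b ≤ b' → R u b → R u b' := by
    intro u hu b hb b' hb' hle h
    exact hΓ.final (hmin u hu) hle ((hmY b).1 hb).2 ((hmY b').1 hb').2 h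
  have hkeep : ∀ y ∈ B', R w y → y ∈ Y.filter (· < c₁) ∨ y = c₂ ∨ y = c₃ ∨ y ∈ Y.filter (c₄ < ·) := by
    intro y hy hwy
    rw [hmB'] at hy
    have hyY := (hmY y).2 ⟨hy.1, hwy⟩
    simp only [Finset.mem_filter, hyY, true_and]
    by_contra hcon
    push Not at hcon hy
    have hy' := hy.2 hwy
    have g1 : c₁ < y := lt_of_le_of_ne hcon.1 (Ne.symm hy'.1)
    have g2 : c₂ < y := lt_of_le_of_ne (le_of_not_gt fun h => absurd (hc₂ y hyY h) (not_le.2 g1))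
      (Ne.symm hcon.2.1)
    have g3 : c₃ < y := lt_of_le_of_ne (le_of_not_gt fun h => absurd (hc₃ y hyY h) (not_le.2 g2))
      (Ne.symm hcon.2.2.1)
    exact absurd (hy'.2 g3) (not_lt.2 hcon.2.2.2)
  have hmid : ∀ p : β → Prop, ∀ [DecidablePred p], (B'.filter fun b => R w b ∧ p b).card ≤
      ((Y.filter (· < c₁)).filter p).card + (({c₂, c₃} : Finset β).filter p).card +
        ((Y.filter (c₄ < ·)).filter p).card := by
    intro p _
    refine le_trans (Finset.card_le_card (t := ((Y.filter (· < c₁)).filter p ∪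
      ({c₂, c₃} : Finset β).filter p) ∪ (Y.filter (c₄ < ·)).filter p) ?_) ?_
    · intro y hy
      rw [Finset.mem_filter] at hy
      simp only [Finset.mem_union, Finset.mem_filter (p := p), Finset.mem_insert,
        Finset.mem_singleton]
      have := hkeep y hy.1 hy.2.1
      tauto
    · refine (Finset.card_union_le _ _).trans ?_
      have := Finset.card_union_le ((Y.filter (· < c₁)).filter p) (({c₂, c₃} : Finset β).filter p)
      omega
  have hlow_le : ∀ p : β → Prop, ∀ [DecidablePred p],
      ((Y.filter (· < c₁)).filter p).card ≤ k + 1 := fun p _ =>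
    (Finset.card_filter_le _ _).trans hlow.le
  have htop_le : ∀ p : β → Prop, ∀ [DecidablePred p],
      ((Y.filter (c₄ < ·)).filter p).card ≤ k + 1 := fun p _ =>
    (Finset.card_filter_le _ _).trans htop.le
  have hmid_le : ∀ p : β → Prop, ∀ [DecidablePred p],
      (({c₂, c₃} : Finset β).filter p).card ≤ 2 := fun p _ =>
    (Finset.card_filter_le _ _).trans Finset.card_le_two
  -- Such a row misses `c₁` and all below it and contains `c₄` and all of `w` above it, hence `k +
  -- 2` elements of each kind. After the deletion only `c₂` and `c₃` can raise either count above `k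
  -- + 1`.
  have hsplit : ∀ u ∈ A', (¬ R u c₁ ∧ R u c₂) ∨ (¬ R u c₃ ∧ R u c₄) →
      IsSplit k R A A' B B' w u := by
    intro u hu hcase
    have huA : u ∈ A := (Finset.mem_filter.1 hu).1
    have n1 : ¬ R u c₁ := by
      rcases hcase with h | h
      · exact h.1
      · exact fun h' => h.1 (hfin u huA _ h₁ _ h₃ (h12.trans h23).le h')
    have y4 : R u c₄ := by
      rcases hcase with h | h
      · exact hfin u huA _ h₂ _ h₄ (h23.trans h34).le h.2
      · exact h.2
    have elow : ∀ y ∈ Y.filter (· < c₁), ¬ R u y := fun y hy h => by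
      rw [Finset.mem_filter] at hy
      exact n1 (hfin u huA _ hy.1 _ h₁ hy.2.le h)
    have etop : ∀ y ∈ Y.filter (c₄ < ·), R u y := fun y hy => by
      rw [Finset.mem_filter] at hy
      exact hfin u huA _ h₄ _ hy.1 hy.2.le y4
    have z1 : ((Y.filter (· < c₁)).filter (R u)).card = 0 := by
      rw [Finset.card_eq_zero, Finset.filter_eq_empty_iff]
      exact fun y hy => elow y hy
    have z2 : ((Y.filter (c₄ < ·)).filter fun b => ¬ R u b).card = 0 := by
      rw [Finset.card_eq_zero, Finset.filter_eq_empty_iff]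
      exact fun y hy h => h (etop y hy)
    have m1 := hmid (fun b => ¬ R u b)
    have m2 := hmid (R u)
    have l1 := hlow_le (fun b => ¬ R u b)
    have l2 := htop_le (R u)
    have l3 := hmid_le (fun b => ¬ R u b)
    have l4 := hmid_le (R u)
    refine ⟨hw, hmin, hu, Finset.filter_subset _ _, htwin, ?_, ?_, (Finset.mem_filter.1 hu).2,
      by omega, by omega, ?_, ⟨c₁, ((hmY _).1 h₁).1, ((hmY _).1 h₁).2, n1, ?_⟩,
      ⟨c₄, ((hmY _).1 h₄).1, ((hmY _).1 h₄).2, y4, ?_⟩⟩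
    · have hs : insert c₁ (Y.filter (· < c₁)) ⊆ B.filter fun b => R w b ∧ ¬ R u b := by
        intro y hy
        rcases Finset.mem_insert.1 hy with rfl | hy
        · exact Finset.mem_filter.2 ⟨((hmY _).1 h₁).1, ((hmY _).1 h₁).2, n1⟩
        · have hyY := (hmY y).1 (Finset.mem_filter.1 hy).1
          exact Finset.mem_filter.2 ⟨hyY.1, hyY.2, elow y hy⟩
      have := Finset.card_le_card hs
      rw [Finset.card_insert_of_notMem (by simp), hlow] at this
      omega
    · have hs : insert c₄ (Y.filter (c₄ < ·)) ⊆ B.filter fun b => R w b ∧ R u b := by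
        intro y hy
        rcases Finset.mem_insert.1 hy with rfl | hy
        · exact Finset.mem_filter.2 ⟨((hmY _).1 h₄).1, ((hmY _).1 h₄).2, y4⟩
        · have hyY := (hmY y).1 (Finset.mem_filter.1 hy).1
          exact Finset.mem_filter.2 ⟨hyY.1, hyY.2, etop y hy⟩
      have := Finset.card_le_card hs
      rw [Finset.card_insert_of_notMem (by simp), htop] at this
      omega
    -- In the lower gap `c₂` and `c₃` are both shared, in the upper gap both missed, so the other
    -- part keeps at most `k + 1` elements.
    · rcases hcase with h | h
      · left
        have y3 := hfin u huA _ h₂ _ h₃ h23.le h.2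
        have : (({c₂, c₃} : Finset β).filter fun b => ¬ R u b).card = 0 := by
          rw [Finset.card_eq_zero, Finset.filter_eq_empty_iff]
          simp [h.2, y3]
        omega
      · right
        have n2 : ¬ R u c₂ := fun h' => h.1 (hfin u huA _ h₂ _ h₃ h23.le h')
        have : (({c₂, c₃} : Finset β).filter (R u)).card = 0 := by
          rw [Finset.card_eq_zero, Finset.filter_eq_empty_iff]
          simp [h.1, n2]
        omega
    · rw [hmB']; exact fun h => h.2 ⟨((hmY _).1 h₁).2, Or.inl rfl⟩
    · rw [hmB']; exact fun h => h.2 ⟨((hmY _).1 h₄).2, Or.inr ⟨h34, le_rfl⟩⟩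
  refine ⟨A', B', Finset.filter_subset _ _, Finset.filter_subset _ _, fun _ => ?_, ?_⟩
  · have hlt : A'.card < A.card := by
      refine Finset.card_lt_card (Finset.filter_ssubset.2 ⟨w, hw, ?_⟩)
      simp
    have : B'.card ≤ B.card := Finset.card_le_card (Finset.filter_subset _ _)
    omega
  · intro l' hl'
    let D := Y.filter fun y => c₃ < y ∧ y ≤ c₄
    have hmD : ∀ y, y ∈ D ↔ y ∈ Y ∧ c₃ < y ∧ y ≤ c₄ := fun y => by simp only [D, Finset.mem_filter]
    have h3B' : c₃ ∈ B' := by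
      rw [hmB']
      refine ⟨((hmY _).1 h₃).1, fun h => ?_⟩
      rcases h.2 with h | h
      · exact absurd h (h12.trans h23).ne'
      · exact lt_irrefl _ h.1
    have h2B' : c₂ ∈ B' := by
      rw [hmB']
      refine ⟨((hmY _).1 h₂).1, fun h => ?_⟩
      rcases h.2 with h | h
      · exact absurd h h12.ne'
      · exact lt_asymm h23 h.1
    have hDB' : ∀ y ∈ D, y ∉ B' := fun y hy h => by
      rw [hmD] at hy
      rw [hmB'] at h
      exact h.2 ⟨((hmY _).1 hy.1).2, Or.inr hy.2⟩
    obtain ⟨l₁, hl₁, hvar₁⟩ := hl'.insert_after (B' := D ∪ B') (c := c₃) h3B'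
      (D.sort_nodup (· ≤ ·)) (fun y hy => hDB' y ((D.mem_sort _).1 hy))
      (fun b => by rw [Finset.mem_union, Finset.mem_sort])
    obtain ⟨l₂, hl₂, hvar₂⟩ := hl₁.insert_after (B' := B) (c := c₂)
      (Finset.mem_union_right _ h2B') (List.nodup_singleton c₁) (by
        intro y hy
        rw [List.mem_singleton] at hy
        subst hy
        rw [Finset.mem_union, hmD, hmB', not_or]
        exact ⟨fun h => lt_asymm (h12.trans h23) h.2.1,
          fun h => h.2 ⟨((hmY _).1 h₁).2, Or.inl rfl⟩⟩) (by
        intro b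
        rw [List.mem_singleton, Finset.mem_union, hmD, hmB', hmY]
        constructor
        · intro hb
          tauto
        · rintro (rfl | h | h)
          · exact ((hmY _).1 h₁).1
          · exact h.1.1
          · exact h.1)
    -- By the final-segment property each row is monotone along `c₃` and the sorted interval, and
    -- constant unless it separates `c₃` from `c₄`.
    have hv : ∀ u ∈ A, variation (R u) (c₃ :: D.sort (· ≤ ·)) ≤ 1 ∧
        ((R u c₄ → R u c₃) → variation (R u) (c₃ :: D.sort (· ≤ ·)) = 0) := by
      intro u hu
      have hmem : ∀ y ∈ D.sort (· ≤ ·), y ∈ Y ∧ c₃ < y ∧ y ≤ c₄ := fun y hy =>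
        (hmD y).1 ((D.mem_sort _).1 hy)
      constructor
      · apply variation_le_one
        rw [List.pairwise_cons]
        refine ⟨fun y hy h => hfin u hu _ h₃ _ (hmem y hy).1 (hmem y hy).2.1.le h, ?_⟩
        have hs : (D.sort (· ≤ ·)).Pairwise (· ≤ ·) := D.pairwise_sort (· ≤ ·)
        exact hs.imp_of_mem fun {x y} hx hy hxy h => hfin u hu _ (hmem x hx).1 _ (hmem y hy).1 hxy h
      · intro h43
        apply variation_eq_zero
        have hall : ∀ x ∈ c₃ :: D.sort (· ≤ ·), (R u x ↔ R u c₃) := by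
          intro x hx
          rcases List.mem_cons.1 hx with rfl | hx
          · rfl
          · exact ⟨fun h => h43 (hfin u hu _ (hmem x hx).1 _ h₄ (hmem x hx).2.2 h),
              fun h => hfin u hu _ h₃ _ (hmem x hx).1 (hmem x hx).2.1.le h⟩
        exact fun x hx y hy => (hall x hx).trans (hall y hy).symm
    have hv' : ∀ u ∈ A, variation (R u) [c₂, c₁] ≤ 1 ∧
        ((R u c₂ → R u c₁) → variation (R u) [c₂, c₁] = 0) := by
      intro u hu
      have := hfin u hu _ h₁ _ h₂ h12.le
      constructor
      · simp only [variation]; split_ifs <;> omega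
      · intro h21
        simp [variation, show R u c₂ ↔ R u c₁ from ⟨h21, this⟩]
    have hle : ∀ u ∈ A, variation (R u) l₂ ≤ variation (R u) l' + 4 := by
      intro u hu
      have := hvar₁ (R u)
      have := hvar₂ (R u)
      have := (hv u hu).1
      have := (hv' u hu).1
      omega
    refine ⟨l₂, hl₂, fun u hu => ⟨fun hu' => ?_, fun _ => hle u hu, fun hu' hns => ?_⟩⟩
    -- A dropped row has at most `(2k + 4) + (k + 3)` members in `B'`, hence at most `6k + 14`
    -- changes there, and 4 more after the insertions.
    · have g1 := hle u hu
      have g2 := hl'.variation_le (R u)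
      have g3 : (B.filter fun b => R u b ∧ ¬ R w b).card ≤ k + 3 := by
        by_contra hcon
        exact hu' (Finset.mem_filter.2 ⟨hu, not_le.1 hcon⟩)
      have g4 : B'.filter (R u) ⊆
          (B'.filter fun b => R w b ∧ R u b) ∪ B.filter fun b => R u b ∧ ¬ R w b := by
        intro b hb
        rw [Finset.mem_filter] at hb
        have hbB := ((hmB' b).1 hb.1).1
        by_cases hwb : R w b
        · exact Finset.mem_union_left _ (Finset.mem_filter.2 ⟨hb.1, hwb, hb.2⟩)
        · exact Finset.mem_union_right _ (Finset.mem_filter.2 ⟨hbB, hb.2, hwb⟩)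
      have g5 := (Finset.card_le_card g4).trans (Finset.card_union_le _ _)
      have g6 := hmid (R u)
      have g7 := hlow_le (R u)
      have g8 := htop_le (R u)
      have g9 := hmid_le (R u)
      omega
    · have hnot : ¬ ((¬ R u c₁ ∧ R u c₂) ∨ (¬ R u c₃ ∧ R u c₄)) :=
        fun h => hns w (hsplit u hu' h)
      have g1 := hvar₁ (R u)
      have g2 := hvar₂ (R u)
      have g3 := (hv u hu).2 (by tauto)
      have g4 := (hv' u hu).2 (by tauto)
      omega

theorem exists_isReduction (k : ℕ) (hΓ : GammaFree R) (A : Finset α) (B : Finset β) :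
    ∃ A' B', IsReduction k R A A' B B' := by
  rcases A.eq_empty_or_nonempty with rfl | hA
  · exact ⟨∅, B, subset_rfl, subset_rfl, by simp, fun l hl => ⟨l, hl, by simp⟩⟩
  by_cases htwin : ∀ b ∈ B, ∀ b' ∈ B, b ≠ b' → ∃ z ∈ A, ¬ (R z b ↔ R z b')
  · by_cases hsmall : (B.filter (R (A.min' hA))).card ≤ 2 * k + 5
    · exact ⟨_, _, isReduction_of_small_row (A.min'_mem hA) hsmall⟩
    · exact isReduction_of_large_row hΓ (A.min'_mem hA) (fun x hx => A.min'_le x hx) htwin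
        (by omega)
  · push Not at htwin
    obtain ⟨b, hb, b', hb', hne, h⟩ := htwin
    exact ⟨_, _, isReduction_of_twins hb hb' hne h⟩

/-- The columns can be enumerated so that every row changes a bounded number of times. -/
theorem exists_enumeration [Fintype α] [Fintype β] (hΓ : GammaFree R)
    (hD : PendantSquareFree k R) :
    ∃ l : List β, l.Nodup ∧ (∀ b, b ∈ l) ∧ ∀ u, variation (R u) l ≤ 6 * k + 42 := by
  classical
  choose fA fB hf using exists_isReduction (R := R) k hΓ
  let s : ℕ → Finset α × Finset β := fun n =>
    (fun x => (fA x.1 x.2, fB x.1 x.2))^[n] (Finset.univ, Finset.univ)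
  let A : ℕ → Finset α := fun n => (s n).1
  let B : ℕ → Finset β := fun n => (s n).2
  have hstep : ∀ n, IsReduction k R (A n) (A (n + 1)) (B n) (B (n + 1)) := by
    intro n
    have : s (n + 1) = (fA (s n).1 (s n).2, fB (s n).1 (s n).2) :=
      Function.iterate_succ_apply' _ _ _
    simp only [A, B, this]
    exact hf _ _
  have hA : Antitone A := antitone_nat_of_succ_le fun n => (hstep n).row_sub
  have hB : Antitone B := antitone_nat_of_succ_le fun n => (hstep n).col_sub
  obtain ⟨N, hN⟩ : ∃ N, A N = ∅ := by
    by_contra hcon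
    push Not at hcon
    have hdec : ∀ n, (A n).card + (B n).card + n ≤ (A 0).card + (B 0).card := by
      intro n
      induction n with
      | zero => simp
      | succ n ih =>
        have := (hstep n).card_lt (hcon n)
        omega
    have := hdec ((A 0).card + (B 0).card + 1)
    omega
  let ev : α → ℕ → Prop := fun u n => ∃ w, IsSplit k R (A n) (A (n + 1)) (B n) (B (n + 1)) w u
  -- The stages are read backwards from `N`, where no row is left and any enumeration will do.
  have key : ∀ n, n ≤ N → ∃ l, Enumerates l (B n) ∧ ∀ u ∈ A n,
      variation (R u) l ≤ 6 * k + 18 + 4 * ((Finset.Ico n N).filter (ev u)).card := by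
    intro n hn
    induction hn using Nat.decreasingInduction with
    | self => exact ⟨(B N).toList, ⟨(B N).nodup_toList, fun b => by simp⟩, by simp [hN]⟩
    | of_succ n hn ih =>
      obtain ⟨l', hl', hbound⟩ := ih
      obtain ⟨l, hl, hlift⟩ := (hstep n).lift l' hl'
      refine ⟨l, hl, fun u hu => ?_⟩
      obtain ⟨g1, g2, g3⟩ := hlift u hu
      by_cases hu' : u ∈ A (n + 1)
      · have hb := hbound u hu'
        rw [← Finset.insert_Ico_succ_left_eq_Ico hn, Order.succ_eq_add_one, Finset.filter_insert]
        by_cases hev : ev u n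
        · rw [if_pos hev, Finset.card_insert_of_notMem (by simp)]
          have := g2 hu'
          omega
        · rw [if_neg hev]
          exact (g3 hu' fun w hw => hev ⟨w, hw⟩).trans hb
      · exact (g1 hu').trans (by omega)
  obtain ⟨l, hl, hbound⟩ := key 0 (Nat.zero_le N)
  refine ⟨l, hl.1, fun b => (hl.2 b).2 (Finset.mem_univ b), fun u => ?_⟩
  have h1 := hbound u (Finset.mem_univ u)
  have h2 : ((Finset.Ico 0 N).filter (ev u)).card ≤ 6 := by
    have : Nonempty α := ⟨u⟩
    choose! w hw using fun n (hn : n ∈ (Finset.Ico 0 N).filter (ev u)) => (Finset.mem_filter.1 hn).2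
    exact card_split_le hΓ hD hA hB hw
  omega

end Reductions

/-! ### From bounded vectors of numbers to binary codes -/

section Encoding

/-- Vectors of `q` numbers below `2 ^ L` correspond to binary words of length `q * L`. -/
noncomputable def vectorEquivBits (q L : ℕ) : (Fin q → Fin (2 ^ L)) ≃ (Fin (q * L) → Bool) :=
  Fintype.equivOfCardEq (by simp [← pow_mul, mul_comm])

/-- A vector of `q` numbers below `2 ^ L`, written as a binary word. -/
noncomputable def vectorCode (q L : ℕ) (f : Fin q → Fin (2 ^ L)) : List Bool :=
  List.ofFn (vectorEquivBits q L f)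

theorem length_vectorCode (q L : ℕ) (f : Fin q → Fin (2 ^ L)) :
    (vectorCode q L f).length = q * L := by
  simp [vectorCode]

theorem vectorCode_injective (q L : ℕ) : Function.Injective (vectorCode q L) :=
  List.ofFn_injective.comp (vectorEquivBits q L).injective

/-- A class admits an implicit representation if adjacency in its graphs is a fixed relation
between vectors of boundedly many numbers that do not exceed the number of vertices. -/
theorem admitsImplicitRepresentation_of_labels {X : GraphClass.{u}} {q : ℕ} (hq : 0 < q)
    (Rel : (Fin q → ℕ) → (Fin q → ℕ) → Prop)
    (h : ∀ (V : Type u) [Fintype V] (G : SimpleGraph V), X V G → ∃ ℓ : V → Fin q → ℕ,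
      (∀ v i, ℓ v i ≤ Fintype.card V) ∧ ∀ v w, G.Adj v w ↔ Rel (ℓ v) (ℓ w))
    (h0 : ¬ Rel (fun _ => 0) (fun _ => 0)) : AdmitsImplicitRepresentation X := by
  classical
  -- The word length `q * L` determines `L`, so the decoder need not know the number of vertices.
  refine ⟨2 * q, fun x y => decide (∃ (L : ℕ) (f g : Fin q → Fin (2 ^ L)), x = vectorCode q L f ∧
    y = vectorCode q L g ∧ Rel (fun i => f i) (fun i => g i)), fun V _ G hG => ?_⟩
  rcases Nat.lt_or_ge 1 (Fintype.card V) with hn | hn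
  · obtain ⟨ℓ, hle, hadj⟩ := h V G hG
    set L := Nat.log 2 (Fintype.card V) with hL
    have hlt : ∀ v i, ℓ v i < 2 ^ (L + 1) := fun v i =>
      (hle v i).trans_lt (Nat.lt_pow_succ_log_self one_lt_two _)
    refine ⟨fun v => vectorCode q (L + 1) fun i => ⟨ℓ v i, hlt v i⟩, fun v => ?_, fun v w => ?_⟩
    -- The length `q * (L + 1)` is at most `2 * q * L` because `L` is positive.
    · have : 1 ≤ L := Nat.log_pos one_lt_two hn
      rw [length_vectorCode]
      nlinarith
    · rw [decide_eq_true_iff, hadj]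
      constructor
      · intro hR
        exact ⟨L + 1, _, _, rfl, rfl, hR⟩
      · rintro ⟨L', f, g, h1, h2, hR⟩
        have hlen := congrArg List.length h1
        rw [length_vectorCode, length_vectorCode] at hlen
        obtain rfl := Nat.eq_of_mul_eq_mul_left hq hlen
        rw [← vectorCode_injective _ _ h1, ← vectorCode_injective _ _ h2] at hR
        exact hR
  -- With at most one vertex only the empty word is allowed. It decodes to zero vectors, which `h0`
  -- excludes.
  · refine ⟨fun _ => [], by simp, fun v w => ?_⟩
    have : Subsingleton V := Fintype.card_le_one_iff_subsingleton.1 hn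
    obtain rfl := Subsingleton.elim v w
    rw [decide_eq_true_iff]
    refine iff_of_false (G.loopless.irrefl v) ?_
    rintro ⟨L, f, g, h1, -, hR⟩
    have hlen := congrArg List.length h1
    rw [length_vectorCode, List.length_nil] at hlen
    obtain rfl : L = 0 := by
      rcases Nat.mul_eq_zero.1 hlen.symm with h | h <;> omega
    have hz : ∀ x : Fin (2 ^ 0), (x : ℕ) = 0 := fun x => by have := x.2; simp at this; omega
    simp only [hz] at hR
    exact h0 hR

/-- The padding value `n` exceeds the position `x`, so it is never counted. -/
theorem card_filter_getD_le (s : List ℕ) (n x : ℕ) (hx : x < n) (m : ℕ) (hm : s.length ≤ m) :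
    (Finset.univ.filter fun i : Fin m => s.getD i n ≤ x).card = s.countP (fun y => y ≤ x) := by
  induction s generalizing m with
  | nil => simp [hx]
  | cons a s ih =>
    obtain ⟨m, rfl⟩ : ∃ m', m = m' + 1 := ⟨m - 1, by simp at hm; omega⟩
    rw [Fin.card_filter_univ_succ, List.countP_cons]
    have := ih m (by simpa using hm)
    simp only [Fin.val_zero, List.getD_cons_zero, Fin.val_succ, List.getD_cons_succ,
      decide_eq_true_eq]
    rw [← this]
    split_ifs <;> simp

end Encoding

/-! ### From induced subgraphs to the bipartite relation -/

section Bipartite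

variable {V : Type*} {G : SimpleGraph V}

/-- The adjacency relation between the two colour classes. -/
def crossAdj (C : G.Coloring (Fin 2)) (a : {v // C v = 0}) (b : {v // C v ≠ 0}) : Prop :=
  G.Adj a b

theorem not_adj_rows (C : G.Coloring (Fin 2)) (a a' : {v // C v = 0}) : ¬ G.Adj a a' := fun h =>
  C.valid h (a.2.trans a'.2.symm)

theorem not_adj_cols (C : G.Coloring (Fin 2)) (b b' : {v // C v ≠ 0}) : ¬ G.Adj b b' := fun h => by
  have h1 := C.valid h
  have h2 := b.2
  have h3 := b'.2
  omega

theorem row_ne_col (C : G.Coloring (Fin 2)) (a : {v // C v = 0}) (b : {v // C v ≠ 0}) :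
    (a : V) ≠ b := fun h => b.2 (h ▸ a.2)

theorem cycleGraph_adj_iff {m : ℕ} (hm : 2 ≤ m) (p q : Fin m) :
    (SimpleGraph.cycleGraph m).Adj p q ↔ (p : ℕ) = q + 1 ∨ (q : ℕ) = p + 1 ∨
      ((p : ℕ) = 0 ∧ (q : ℕ) + 1 = m) ∨ ((q : ℕ) = 0 ∧ (p : ℕ) + 1 = m) := by
  rw [SimpleGraph.cycleGraph_adj']
  have key : ∀ p q : Fin m, ((p - q : Fin m) : ℕ) = 1 ↔
      (p : ℕ) = q + 1 ∨ ((p : ℕ) = 0 ∧ (q : ℕ) + 1 = m) := by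
    intro p q
    have := p.2
    have := q.2
    rcases le_or_gt q p with h | h
    · rw [Fin.coe_sub_iff_le.2 h]
      rw [Fin.le_def] at h
      omega
    · rw [Fin.coe_sub_iff_lt.2 h]
      rw [Fin.lt_def] at h
      omega
  rw [key, key]
  omega

/-- In a cycle with at least three rows the neighbourhoods are pairwise distinct, which makes the
rows, and likewise the columns, distinct. -/
theorem eq_of_cycle_pattern {n : ℕ} (hn : 3 ≤ n) {i j : ℕ} (hi : i < n) (hj : j < n)
    (h : ∀ l, l < n → (((i = 0 ∧ l = 0) ∨ (i + 1 = n ∧ l + 1 = n) ∨ i + 1 = l ∨ l + 1 = i) ↔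
      ((j = 0 ∧ l = 0) ∨ (j + 1 = n ∧ l + 1 = n) ∨ j + 1 = l ∨ l + 1 = j))) : i = j := by
  wlog hij : i ≤ j generalizing i j
  · exact (this hj hi (fun l hl => (h l hl).symm) (by omega)).symm
  by_contra hne
  have h1 := h (i + 1) (by omega)
  have h2 := h j hj
  have h3 := h (i - 1) (by omega)
  by_cases hj' : j + 1 < n
  · have h4 := h (j + 1) hj'
    omega
  · omega

theorem noInducedCycle_crossAdj (C : G.Coloring (Fin 2))
    (hG : ∀ m : ℕ, 6 ≤ m → ¬ (SimpleGraph.cycleGraph m).IsIndContained G) :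
    NoInducedCycle (crossAdj C) := by
  intro n hn r c hrc
  refine hG (2 * n) (by omega) ⟨?_⟩
  -- The cycle runs through the indices upwards and then back, alternating between rows and columns.
  let ix : ℕ → ℕ := fun p => if p < n then p else 2 * n - 1 - p
  have hix : ∀ p, p < 2 * n → ix p < n := fun p hp => by simp only [ix]; split_ifs <;> omega
  let f : Fin (2 * n) → V := fun p =>
    if (p : ℕ) % 2 = 0 then (r (ix p) : V) else (c (ix p) : V)
  have hr : ∀ i j, i < n → j < n → r i = r j → i = j := fun i j hi hj e =>
    eq_of_cycle_pattern hn hi hj fun l hl => by rw [← hrc i l hi hl, ← hrc j l hj hl, e]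
  have hc : ∀ i j, i < n → j < n → c i = c j → i = j := fun i j hi hj e =>
    eq_of_cycle_pattern hn hi hj fun l hl => by
      have h1 := hrc l i hl hi
      have h2 := hrc l j hl hj
      rw [e] at h1
      have := h1.symm.trans h2
      omega
  have hinj : Function.Injective f := by
    intro p q hpq
    have hp := hix p p.2
    have hq := hix q q.2
    have hpp := p.2
    have hqq := q.2
    rw [Fin.ext_iff]
    simp only [f] at hpq
    split_ifs at hpq with h1 h2 h2
    · have := hr _ _ hp hq (Subtype.ext hpq)
      simp only [ix] at this; split_ifs at this <;> omega
    · exact absurd hpq (row_ne_col C _ _)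
    · exact absurd hpq.symm (row_ne_col C _ _)
    · have := hc _ _ hp hq (Subtype.ext hpq)
      simp only [ix] at this; split_ifs at this <;> omega
  have hcross : ∀ p q : Fin (2 * n), (p : ℕ) % 2 = 0 → (q : ℕ) % 2 ≠ 0 →
      (G.Adj (r (ix p)) (c (ix q)) ↔ (SimpleGraph.cycleGraph (2 * n)).Adj p q) := by
    intro p q hp hq
    have hpp := p.2
    have hqq := q.2
    have := hrc (ix p) (ix q) (hix p p.2) (hix q q.2)
    rw [crossAdj] at this
    rw [this, cycleGraph_adj_iff (by omega)]
    simp only [ix]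
    split_ifs <;> omega
  refine ⟨⟨f, hinj⟩, fun {p q} => ?_⟩
  have hpp := p.2
  have hqq := q.2
  simp only [Function.Embedding.coeFn_mk, f]
  split_ifs with h1 h2 h2
  · refine iff_of_false (not_adj_rows C _ _) ?_
    rw [cycleGraph_adj_iff (by omega)]; omega
  · exact hcross p q h1 h2
  · exact (G.adj_comm _ _).trans ((hcross q p h2 h1).trans (SimpleGraph.adj_comm _ _ _))
  · refine iff_of_false (not_adj_cols C _ _) ?_
    rw [cycleGraph_adj_iff (by omega)]; omega

theorem pendantSquareFree_crossAdj {k : ℕ} (C : G.Coloring (Fin 2))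
    (hG : ¬ (graphD k).IsIndContained G) : PendantSquareFree k (crossAdj C) := by
  intro u v z i j p T ui vi zi uj vj zj up vp zp hT
  by_contra hcard
  push Not at hcard
  obtain ⟨e⟩ : Nonempty (Fin k ↪ T) := Function.Embedding.nonempty_of_card_le (by simpa using hcard)
  have hv : ∀ t, G.Adj v (e t : {v // C v ≠ 0}) := fun t => (hT _ (e t).2).1
  have hu : ∀ t, ¬ G.Adj u (e t : {v // C v ≠ 0}) := fun t => (hT _ (e t).2).2.1
  have hz : ∀ t, ¬ G.Adj z (e t : {v // C v ≠ 0}) := fun t => (hT _ (e t).2).2.2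
  simp only [crossAdj] at ui vi zi uj vj zj up vp zp
  -- Here `v₁`, `v₂`, `v₃`, `v₄` are `i`, `u`, `j`, `v`; the pendants at `v₁` and `v₂` are `z` and
  -- `p`.
  let f : Fin 4 ⊕ (Fin 2 ⊕ Fin k) → V :=
    Sum.elim ![i, u, j, v] (Sum.elim ![z, p] fun t => (e t : {v // C v ≠ 0}))
  have hadj : ∀ x y, G.Adj (f x) (f y) ↔ (graphD k).Adj x y := by
    have e1 := not_adj_rows C
    have e2 := not_adj_cols C
    have hc : ∀ x y : Fin 4, (SimpleGraph.cycleGraph 4).Adj x y ↔ ((x : ℕ) + y) % 2 = 1 := by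
      decide
    rintro (x | x | x) (y | y | y)
    · fin_cases x <;> fin_cases y <;> simp [f, graphD, withPendants, G.adj_comm, *]
    · fin_cases x <;> fin_cases y <;> simp [f, graphD, withPendants, G.adj_comm, *]
    · fin_cases x <;> simp [f, graphD, withPendants, *]
    · fin_cases x <;> fin_cases y <;> simp [f, graphD, withPendants, G.adj_comm, *]
    · fin_cases x <;> fin_cases y <;> simp [f, graphD, withPendants, G.adj_comm, *]
    · fin_cases x <;> simp [f, graphD, withPendants, *]
    · fin_cases y <;> simp [f, graphD, withPendants, G.adj_comm, *]
    · fin_cases y <;> simp [f, graphD, withPendants, G.adj_comm, *]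
    · simp [f, graphD, withPendants, e2]
  have uv : (u : V) ≠ v := fun h => vp (h ▸ up)
  have uz : (u : V) ≠ z := fun h => zj (h ▸ uj)
  have vz : (v : V) ≠ z := fun h => zj (h ▸ vj)
  have ij : (i : V) ≠ j := fun h => zj (h ▸ zi)
  have ip : (i : V) ≠ p := fun h => vp (h ▸ vi)
  have jp : (j : V) ≠ p := fun h => vp (h ▸ vj)
  have ie : ∀ t, (i : V) ≠ (e t : {v // C v ≠ 0}) := fun t h => hu t (h ▸ ui)
  have je : ∀ t, (j : V) ≠ (e t : {v // C v ≠ 0}) := fun t h => hu t (h ▸ uj)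
  have pe : ∀ t, (p : V) ≠ (e t : {v // C v ≠ 0}) := fun t h => hu t (h ▸ up)
  have rc := row_ne_col C
  have cr := fun a b => (rc a b).symm
  have hinj : Function.Injective f := by
    rintro (x | x | x) (y | y | y)
    · fin_cases x <;> fin_cases y <;>
        simp [f, uv, uv.symm, ij, ij.symm, rc, cr]
    · fin_cases x <;> fin_cases y <;> simp [f, uz, vz, ip, jp, rc, cr]
    · fin_cases x <;> simp [f, ie, je, rc]
    · fin_cases x <;> fin_cases y <;> simp [f, uz.symm, vz.symm, ip.symm, jp.symm, rc, cr]
    · fin_cases x <;> fin_cases y <;> simp [f, rc, cr]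
    · fin_cases x <;> simp [f, pe, rc]
    · fin_cases y <;> simp [f, fun t => (ie t).symm, fun t => (je t).symm, cr]
    · fin_cases y <;> simp [f, fun t => (pe t).symm, cr]
    · simp [f, Subtype.coe_inj]
  exact hG ⟨⟨⟨f, hinj⟩, fun {x y} => hadj x y⟩⟩

/-- A `D_k`-free chordal bipartite graph has an enumeration of one colour class along which every
vertex of the other class changes adjacency a bounded number of times. -/
theorem exists_enumeration_crossAdj [Fintype V] {k : ℕ} (C : G.Coloring (Fin 2))
    (hcyc : ∀ m : ℕ, 6 ≤ m → ¬ (SimpleGraph.cycleGraph m).IsIndContained G)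
    (hD : ¬ (graphD k).IsIndContained G) :
    ∃ l : List {v // C v ≠ 0}, l.Nodup ∧ (∀ b, b ∈ l) ∧
      ∀ u, variation (crossAdj C u) l ≤ 6 * k + 42 := by
  classical
  obtain ⟨ρ, κ, hρ, hκ, hR, hC⟩ := exists_doubly_lexical (crossAdj C)
  let _ : LinearOrder {v // C v = 0} := LinearOrder.lift' ρ hρ
  let _ : LinearOrder {v // C v ≠ 0} := LinearOrder.lift' κ hκ
  have hΓ : GammaFree (crossAdj C) := fun a a' b b' ha hb h1 h2 h3 =>
    gamma_free_of_doubly_lexical hR hC (noInducedCycle_crossAdj C hcyc) ha hb h1 h2 h3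
  exact exists_enumeration hΓ (pendantSquareFree_crossAdj C hD)

end Bipartite

/-! ### The labelling -/

/-- The first vector encodes the switches of a row, the second the position of a column, and the
row contains the column. -/
def RowContains {q : ℕ} (f g : Fin (q + 1) → ℕ) : Prop :=
  f 0 = 1 ∧ g 0 = 0 ∧ ¬ Even (Finset.univ.filter fun i : Fin q => f i.succ ≤ g i.succ).card

theorem mainTheorem6 (k : ℕ) :
    AdmitsImplicitRepresentation (dFreeChordalBipartite.{u} k) := by
  classical
  -- With initial state `False` there may be one switch more than changes, hence `6k + 43`; one
  -- further entry flags the colour class.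
  refine admitsImplicitRepresentation_of_labels (q := 6 * k + 43 + 1) (Nat.succ_pos _)
    (fun f g => RowContains f g ∨ RowContains g f) (fun V _ G hG => ?_) (by simp [RowContains])
  obtain ⟨⟨⟨C⟩, hcyc⟩, hD⟩ := hG
  obtain ⟨l, hnd, hmem, hvar⟩ := exists_enumeration_crossAdj C hcyc hD
  set n := Fintype.card V
  have hl : l.length ≤ n := hnd.length_le_card.trans (Fintype.card_subtype_le _)
  let s : {v // C v = 0} → List ℕ := fun a => switches (crossAdj C a) False 0 l
  let ℓ : V → Fin (6 * k + 43 + 1) → ℕ := fun v =>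
    if h : C v = 0 then Fin.cons 1 fun i : Fin (6 * k + 43) => (s ⟨v, h⟩).getD i n
    else Fin.cons 0 fun _ => l.idxOf ⟨v, h⟩
  have hrow : ∀ a : {v // C v = 0}, ℓ a = Fin.cons 1 fun i : Fin (6 * k + 43) => (s a).getD i n :=
    fun a => dif_pos a.2
  have hcol : ∀ b : {v // C v ≠ 0}, ℓ b = Fin.cons 0 fun _ => l.idxOf b := fun b => dif_neg b.2
  have hcross : ∀ (a : {v // C v = 0}) (b : {v // C v ≠ 0}),
      G.Adj a b ↔ RowContains (ℓ a) (ℓ b) := by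
    intro a b
    have hidx : l.idxOf b < l.length := List.idxOf_lt_length_of_mem (hmem b)
    have h1 := get_iff_switches (crossAdj C a) l False 0 _ hidx
    rw [List.getElem_idxOf] at h1
    have h2 : (s a).length ≤ 6 * k + 43 := (length_switches_le _ _ _ _).trans
      (Nat.succ_le_succ (hvar a))
    have h3 := card_filter_getD_le (s a) n (l.idxOf b) (hidx.trans_le hl) _ h2
    rw [RowContains, hrow, hcol]
    simp only [Fin.cons_zero, Fin.cons_succ, true_and]
    rw [h3, ← crossAdj, h1]
    simp [s]
  refine ⟨ℓ, fun v i => ?_, fun v w => ?_⟩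
  · have hn : 1 ≤ n := Fintype.card_pos_iff.2 ⟨v⟩
    by_cases h : C v = 0
    · rw [hrow ⟨v, h⟩]
      refine Fin.cases hn (fun i => ?_) i
      rw [Fin.cons_succ]
      rcases Nat.lt_or_ge i (s ⟨v, h⟩).length with hi | hi
      · rw [List.getD_eq_getElem _ _ hi]
        have := le_of_mem_switches _ _ _ _ _ (List.getElem_mem hi)
        omega
      · rw [List.getD_eq_default _ _ hi]
    · rw [hcol ⟨v, h⟩]
      refine Fin.cases (Nat.zero_le _) (fun i => ?_) i
      rw [Fin.cons_succ]
      exact List.idxOf_le_length.trans hl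
  · by_cases hv : C v = 0 <;> by_cases hw : C w = 0
    · refine iff_of_false (not_adj_rows C ⟨v, hv⟩ ⟨w, hw⟩) ?_
      simp [RowContains, hrow ⟨v, hv⟩, hrow ⟨w, hw⟩]
    · rw [hcross ⟨v, hv⟩ ⟨w, hw⟩]
      simp [RowContains, hrow ⟨v, hv⟩, hcol ⟨w, hw⟩]
    · rw [G.adj_comm, hcross ⟨w, hw⟩ ⟨v, hv⟩]
      simp [RowContains, hrow ⟨w, hw⟩, hcol ⟨v, hv⟩]
    · refine iff_of_false (not_adj_cols C ⟨v, hv⟩ ⟨w, hw⟩) ?_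
      simp [RowContains, hcol ⟨v, hv⟩, hcol ⟨w, hw⟩]
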